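/- **Environment.** A piecewise stationary bandit with $A$ arms and horizon $T$ has change-points $\nu_0=1<\nu_1<\dots<\nu_{N_T}<\nu_{N_T+1}=T+1$ with $N_T\ge 1$. Rewards are independent over time. In the $k$-th interval $\{\nu_{k-1},\dots,\nu_k-1\}$ the rewards of arm $a$ have a fixed $\sigma^2$-sub-Gaussian law with mean $\mu_{a,k}$, where $\sigma^2$-sub-Gaussian means that the centered cumulant generating function is at most $\sigma^2\theta^2/2$ for all real $\theta$. Assume $\max_{a'}\mu_{a',k}-\mu_{a,k}\le C$ for all $a$ and all $1\le k\le N_T+1$, and $\max_a|\mu_{a,k+1}-\mu_{a,k}|\ge\underline\Delta_c>0$ for all $1\le k\le N_T$. Let $L_T=\min_{1\le k\le N_T}(\nu_k-\nu_{k-1})$. The regret of a procedure that plays the arms $a_t$ is $$R_T=\mathbb E\Big[\sum_{k=1}^{N_T+1}\sum_{t=\nu_{k-1}}^{\nu_k-1}\big(\max_a\mu_{a,k}-\mu_{a_t,k}\big)\Big].$$ **Bandit algorithm.** Let $\mathcal B$ be a stationary bandit algorithm, given for every number of arms $A\geq 1$, that maps the list of past (arm, reward) pairs to the next arm. Let $R_{\mathcal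 B}(A,n)$ bound its regret over $n$ rounds on every stationary $A$-armed instance with $\sigma^2$-sub-Gaussian rewards and suboptimality gaps at most $C$. Assume $R_{\mathcal B}=\mathcal O(\sqrt{An\log n})$: there is a constant $c$ such that for every $A$, $R_{\mathcal B}(A,n)\le c\sqrt{An\log n}$ for all sufficiently large $n$. **Change detector.** For a horizon $M$ and levels $\delta_F,\delta_D\in(0,1)$, let $\mathcal D$ be a causal change detector of real samples, with stopping time $\tau$. Let $\mathbb P_\nu$ be the law of independent samples that have law $f_0$ before the $\nu$-th sample and law $f_1$ from the $\nu$-th sample on; $\nu=\infty$ means no change. The laws $f_0,f_1$ are $\sigma^2$-sub-Gaussian, with means that differ in absolute value by $\Delta>0$. Assume $\mathbb P_\infty(\tau\le M)\le\delta_F$ for every $f_0$. Let $m=m(\Delta,M,\delta_F,\delta_D)$ be its pre-change window. Let $d=d(\Delta,M,\delta_F,\delta_D)$ be its latency, or any upper bound of it, where the latency is the least $t\in\{1,\dots,M\}$ such that $\mathbb P_\nu(\tau\ge\nu+t)\le\delta_D$ for all $\nu\in\{m+1,\dots,M-t\}$ and all such $f_0,f_1$. Assume that $m$ and $d$ are nonincreasing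 in $\Delta$ and nondecreasing in $M$. Assume also that for every $\Delta>0$ there is a constant $K_\Delta$ such that for all sufficiently large $M$ and all $\delta_F,\delta_D\in(0,1)$, $$m+d\le K_\Delta\big(\log M+\log(1/\delta_F)+\log(1/\delta_D)\big).$$ **Procedure.** Fix $\gamma>1$ and $\alpha_0>0$. Use the detector with $M=T$ and $\delta_F=\delta_D=T^{-\gamma}$, and set $\alpha_k=\alpha_0\sqrt{kA\log T/T}$. Start with last restart $\tau=0$, counter $k=1$ and empty histories. At time $t=1,\dots,T$, let $r=((t-\tau-1)\bmod\lceil A/\alpha_k\rceil)+1$. - If $r\le A$, play arm $r$ (forced exploration), append the reward to the detector history of that arm, and apply the detector to this history. If it declares a change, set $\tau\leftarrow t$, increase $k$ by one and erase all histories. - If $r>A$, play the arm chosen by $\mathcal B$ from its own history, and append the arm and its reward to that history. **Claim.** Let $m_k=\lceil A/\alpha_k\rceil\, m(\underline\Delta_c,T,T^{-\gamma},T^{-\gamma})$ and $d_k=\lceil A/\alpha_k\rceil\, d(\underline\Delta_c,T,T^{-\gamma},T^{-\gamma})$ for $k\ge 1$, and $d_0=0$. There is a constant $K>0$, depending only on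 $\sigma,C,\underline\Delta_c,\alpha_0,\gamma$, the bandit algorithm with its bound $R_{\mathcal B}$, and the detector with $m$ and $d$ (and not on $A$, $T$ or the environment), such that the following holds. For every $A\ge 1$ there is a constant $K_0>0$ such that for all sufficiently large $T$, every environment as above with $A$ arms and horizon $T$ that satisfies $L_T\ge K_0\sqrt{T\log T}$ satisfies the separation condition $$d_{k-1}+m_k\le\nu_k-\nu_{k-1}\quad\text{for all }1\le k\le N_T,$$ and the procedure has regret $$R_T\le K\sqrt{A\,N_T\,T\log T}.$$ -/

import Mathlib

open MeasureTheory ProbabilityTheory Filter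
open scoped NNReal

namespace DAB

/-! ### Reward laws -/

/-- The mean of a law on the real line. -/
noncomputable def mean (P : ProbabilityMeasure ℝ) : ℝ :=
  ∫ x, x ∂(P : Measure ℝ)

/-- `P` is `σ²`-sub-Gaussian: after centering, its moment generating function is finite and at most
`exp (σ² θ² / 2)` for every real `θ`. -/
def IsSubGaussian (σ : ℝ≥0) (P : ProbabilityMeasure ℝ) : Prop :=
  HasSubgaussianMGF (fun x : ℝ => x - mean P) (σ ^ 2) (P : Measure ℝ)

/-- Suboptimality gap of arm `a` in the stationary bandit instance with arm laws `P`. -/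
noncomputable def gap {A : ℕ} (P : Fin A → ProbabilityMeasure ℝ) (a : Fin A) : ℝ :=
  (⨆ b, mean (P b)) - mean (P a)

/-! ### Stationary bandit algorithms -/

/-- A bandit algorithm on `A` arms: it maps the list of past (arm, reward) pairs, in chronological
order, to the next arm. -/
structure BanditAlg (A : ℕ) where
  act : List (Fin A × ℝ) → Fin A
  measurable_act : ∀ n : ℕ, Measurable fun h : Fin n → Fin A × ℝ => act (List.ofFn h)

/-- History of the algorithm after `n` rounds on the reward table `x`, where `x i a` is the reward
that arm `a` yields in round `i + 1`. -/
def BanditAlg.history {A : ℕ} (B : BanditAlg A) (x : ℕ → Fin A → ℝ) : ℕ → List (Fin A × ℝ)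
  | 0 => []
  | n + 1 =>
    B.history x n ++ [(B.act (B.history x n), x n (B.act (B.history x n)))]

/-- Expected regret over `n` rounds on the stationary instance with arm laws `P`: rewards are
independent over rounds, and arm `a` always has law `P a`. -/
noncomputable def BanditAlg.regret {A : ℕ} (B : BanditAlg A)
    (P : Fin A → ProbabilityMeasure ℝ) (n : ℕ) : ℝ :=
  ∫ x, ∑ i ∈ Finset.range n, gap P (B.act (B.history x i))
    ∂(Measure.infinitePi fun _ : ℕ => Measure.pi fun a => (P a : Measure ℝ))

/-- `R` is a minimax regret upper bound for `B`: it bounds the regret over `n` rounds, for every `n`,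
on all stationary instances with `σ²`-sub-Gaussian rewards and suboptimality gaps at most `C`. -/
def BanditAlg.HasRegretBound {A : ℕ} (B : BanditAlg A) (σ : ℝ≥0) (C : ℝ) (R : ℕ → ℝ) : Prop :=
  ∀ P : Fin A → ProbabilityMeasure ℝ,
    (∀ a, IsSubGaussian σ (P a)) → (∀ a, gap P a ≤ C) → ∀ n, B.regret P n ≤ R n

/-! ### Change detectors -/

/-- A causal change detector: it maps the list of the samples seen so far, in chronological order, to
the decision whether to declare a change. -/
structure ChangeDetector where
  alarm : List ℝ → Bool
  measurable_alarm : ∀ n : ℕ, Measurable fun h : Fin n → ℝ => alarm (List.ofFn h)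

/-- The number of samples after which the detector first declares a change (`⊤` if it never does);
the `n`-th sample is `x (n - 1)`. -/
noncomputable def ChangeDetector.stoppingTime (D : ChangeDetector) (x : ℕ → ℝ) : ℕ∞ :=
  sInf {τ : ℕ∞ | ∃ n : ℕ, 1 ≤ n ∧ D.alarm (List.ofFn fun i : Fin n => x i) = true ∧ τ = n}

/-- Law of a sequence of independent samples whose `n`-th term, `n ≥ 1`, has law `f₀` if `n < ν` and
`f₁` if `n ≥ ν`. For `ν = ⊤` there is no change. -/
noncomputable def changeLaw (f₀ f₁ : ProbabilityMeasure ℝ) (ν : ℕ∞) : Measure (ℕ → ℝ) :=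
  open Classical in
  Measure.infinitePi fun i : ℕ =>
    ((if ((i + 1 : ℕ) : ℕ∞) < ν then f₀ else f₁ : ProbabilityMeasure ℝ) : Measure ℝ)

/-- The latency over the horizon `M` at level `δD`, for mean shift `Δ` and pre-change window `w`: the
least `t` in `{1, …, M}` such that the probability of `τ ≥ ν + t` is at most `δD` whenever the
change-point `ν` lies in `{w + 1, …, M - t}`, whatever the pre- and post-change laws. -/
noncomputable def ChangeDetector.latency (D : ChangeDetector) (σ : ℝ≥0) (δD Δ : ℝ) (M w : ℕ) : ℕ :=
  sInf {t : ℕ | 1 ≤ t ∧ t ≤ M ∧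
    ∀ f₀ f₁ : ProbabilityMeasure ℝ, IsSubGaussian σ f₀ → IsSubGaussian σ f₁ →
      |mean f₀ - mean f₁| = Δ → ∀ ν : ℕ, w + 1 ≤ ν → ν ≤ M - t →
        (changeLaw f₀ f₁ ν).real {x | ((ν + t : ℕ) : ℕ∞) ≤ D.stoppingTime x} ≤ δD}

/-- The requirements on a family of change detectors `D M δF δD`, indexed by the horizon `M` and the
performance levels `δF`, `δD`. The pre-change window `m` and the latency `d` are functions of the
mean shift, the horizon and the two levels. It suffices that `d` is an upper bound of the latency; in
particular, `d` may be the latency itself. -/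
structure IsGoodDetector (σ : ℝ≥0) (D : ℕ → ℝ → ℝ → ChangeDetector)
    (m d : ℝ → ℕ → ℝ → ℝ → ℕ) : Prop where
  /-- the probability of a false alarm over the horizon is at most `δF` -/
  false_alarm : ∀ (M : ℕ) (δF δD : ℝ), δF ∈ Set.Ioo 0 1 → δD ∈ Set.Ioo 0 1 →
    ∀ f : ProbabilityMeasure ℝ, IsSubGaussian σ f →
      (changeLaw f f ⊤).real {x | (D M δF δD).stoppingTime x ≤ (M : ℕ∞)} ≤ δF
  latency_le : ∀ (Δ : ℝ) (M : ℕ) (δF δD : ℝ), 0 < Δ → δF ∈ Set.Ioo 0 1 → δD ∈ Set.Ioo 0 1 →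
    (D M δF δD).latency σ δD Δ M (m Δ M δF δD) ≤ d Δ M δF δD
  /-- `m` and `d` decrease with the mean shift -/
  antitone_shift : ∀ (M : ℕ) (δF δD : ℝ), δF ∈ Set.Ioo 0 1 → δD ∈ Set.Ioo 0 1 →
    AntitoneOn (fun Δ => m Δ M δF δD) (Set.Ioi 0) ∧ AntitoneOn (fun Δ => d Δ M δF δD) (Set.Ioi 0)
  /-- `m` and `d` increase with the horizon -/
  monotone_horizon : ∀ (Δ δF δD : ℝ), 0 < Δ → δF ∈ Set.Ioo 0 1 → δD ∈ Set.Ioo 0 1 →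
    Monotone (fun M => m Δ M δF δD) ∧ Monotone (fun M => d Δ M δF δD)
  /-- for each fixed mean shift, `m + d` is at most of the order
  `log M + log (1 / δF) + log (1 / δD)` -/
  log_growth : ∀ Δ : ℝ, 0 < Δ → ∃ K : ℝ, ∀ᶠ M : ℕ in atTop, ∀ δF ∈ Set.Ioo (0 : ℝ) 1,
    ∀ δD ∈ Set.Ioo (0 : ℝ) 1,
      ((m Δ M δF δD + d Δ M δF δD : ℕ) : ℝ) ≤
        K * (Real.log M + Real.log (1 / δF) + Real.log (1 / δD))

/-! ### Piecewise stationary bandits -/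

/-- A piecewise stationary bandit with `A` arms and horizon `T`: it has `N` change-points
`1 = ν 0 < ν 1 < … < ν N < ν (N + 1) = T + 1`, and `law k a` is the law of the rewards of arm `a` in
the `k`-th interval `{ν (k - 1), …, ν k - 1}`, `1 ≤ k ≤ N + 1`. -/
structure PSBandit (A T : ℕ) where
  N : ℕ
  ν : ℕ → ℕ
  ν_zero : ν 0 = 1
  ν_last : ν (N + 1) = T + 1
  ν_lt : ∀ k ≤ N, ν k < ν (k + 1)
  law : ℕ → Fin A → ProbabilityMeasure ℝ

namespace PSBandit

variable {A T : ℕ} (E : PSBandit A T)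

/-- The index `k` of the interval `{ν (k - 1), …, ν k - 1}` that contains the time `t`. -/
def interval (t : ℕ) : ℕ :=
  ((Finset.range (E.N + 1)).filter fun j => E.ν j ≤ t).card

/-- Law of the reward table `x`, where `x t a` is the reward of arm `a` at time `t`: rewards are
independent over time, with the arm laws of the interval that contains `t`. -/
noncomputable def rewardLaw : Measure (ℕ → Fin A → ℝ) :=
  Measure.infinitePi fun t : ℕ => Measure.pi fun a => (E.law (E.interval t) a : Measure ℝ)

/-- The largest mean shift, over the arms, at the `k`-th change-point. -/
noncomputable def changeGap (k : ℕ) : ℝ :=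
  ⨆ a, |mean (E.law (k + 1) a) - mean (E.law k a)|

/-- Standing assumptions: `σ²`-sub-Gaussian rewards, suboptimality gaps at most `C`, change gaps at
least `Δ`. -/
structure Admissible (σ : ℝ≥0) (C Δ : ℝ) : Prop where
  subGaussian : ∀ k ∈ Finset.Icc 1 (E.N + 1), ∀ a, IsSubGaussian σ (E.law k a)
  gap_le : ∀ k ∈ Finset.Icc 1 (E.N + 1), ∀ a, gap (E.law k) a ≤ C
  le_changeGap : ∀ k ∈ Finset.Icc 1 E.N, Δ ≤ E.changeGap k

/-- The minimum change-point separation: the minimum of `ν k - ν (k - 1)` over `1 ≤ k ≤ N`. -/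
noncomputable def minSeparation : ℕ :=
  sInf ((fun k => E.ν k - E.ν (k - 1)) '' Set.Icc 1 E.N)

end PSBandit

/-! ### The detection augmented bandit procedure -/

/-- Number of rounds per cycle of forced exploration, `⌈A / α k⌉`. -/
noncomputable def period (A : ℕ) (α : ℕ → ℝ) (k : ℕ) : ℕ :=
  ⌈(A : ℝ) / α k⌉₊

/-- Internal state of the procedure: time of the last restart, index of the current interval between
restarts, histories of the change detectors (one for each arm), history of the bandit algorithm. -/
structure State (A : ℕ) where
  restart : ℕ
  index : ℕ
  histD : Fin A → List ℝ
  histB : List (Fin A × ℝ)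

/-- Initial state. -/
def State.init (A : ℕ) : State A := ⟨0, 1, fun _ => [], []⟩

/-- Position of round `t` in the current cycle of forced exploration, counted from `0`. Arm number
`r + 1` is explored at position `r`, for `r < A`. -/
noncomputable def State.phase {A : ℕ} (s : State A) (α : ℕ → ℝ) (t : ℕ) : ℕ :=
  (t - s.restart - 1) % period A α s.index

/-- The arm played at time `t` from the state `s`: the arm due for forced exploration, if any, and
otherwise the arm chosen by the bandit algorithm. -/
noncomputable def State.arm {A : ℕ} (s : State A) (B : BanditAlg A) (α : ℕ → ℝ) (t : ℕ) : Fin A :=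
  if h : s.phase α t < A then ⟨s.phase α t, h⟩ else B.act s.histB

/-- The update at time `t` from the state `s`, on the reward table `x`. The change detectors receive
the samples of forced exploration and the bandit algorithm receives the other samples. When a
detector declares a change, all histories are erased. -/
noncomputable def State.step {A : ℕ} (s : State A) (B : BanditAlg A) (D : ChangeDetector)
    (α : ℕ → ℝ) (x : ℕ → Fin A → ℝ) (t : ℕ) : State A :=
  let a := s.arm B α t
  if s.phase α t < A then
    if D.alarm (s.histD a ++ [x t a]) then
      ⟨t, s.index + 1, fun _ => [], []⟩
    else
      { s with histD := Function.update s.histD a (s.histD a ++ [x t a]) }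
  else
    { s with histB := s.histB ++ [(a, x t a)] }

/-- State of the procedure after `t` rounds. -/
noncomputable def state {A : ℕ} (B : BanditAlg A) (D : ChangeDetector) (α : ℕ → ℝ)
    (x : ℕ → Fin A → ℝ) : ℕ → State A
  | 0 => State.init A
  | t + 1 => (state B D α x t).step B D α x (t + 1)

/-- The arm that the procedure plays at time `t ≥ 1`. -/
noncomputable def action {A : ℕ} (B : BanditAlg A) (D : ChangeDetector) (α : ℕ → ℝ)
    (x : ℕ → Fin A → ℝ) (t : ℕ) : Fin A :=
  (state B D α x (t - 1)).arm B α t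

/-- The dynamic regret of the procedure in the environment `E` over the horizon `T`. -/
noncomputable def regret {A T : ℕ} (E : PSBandit A T) (B : BanditAlg A) (D : ChangeDetector)
    (α : ℕ → ℝ) : ℝ :=
  ∫ x, ∑ k ∈ Finset.Icc 1 (E.N + 1), ∑ t ∈ Finset.Ico (E.ν (k - 1)) (E.ν k),
      gap (E.law k) (action B D α x t) ∂E.rewardLaw

/-- The latency of the procedure at the `k`-th change-point, when that of the change detector is `d`;
it is `0` for `k = 0`. -/
noncomputable def latencyAt (A : ℕ) (α : ℕ → ℝ) (d k : ℕ) : ℕ :=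
  if k = 0 then 0 else period A α k * d

/-- The pre-change window of the procedure at the `k`-th change-point, when that of the change
detector is `m`. -/
noncomputable def windowAt (A : ℕ) (α : ℕ → ℝ) (m k : ℕ) : ℕ :=
  period A α k * m

/-- The separation condition `d_{k-1} + m_k ≤ ν_k - ν_{k-1}` for all `1 ≤ k ≤ N`. -/
def SeparationCondition {A T : ℕ} (E : PSBandit A T) (α : ℕ → ℝ) (m d : ℕ) : Prop :=
  ∀ k ∈ Finset.Icc 1 E.N,
    latencyAt A α d (k - 1) + windowAt A α m k ≤ E.ν k - E.ν (k - 1)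

/-- The forced exploration frequencies `α_k = α₀ √(k A log T / T)`. -/
noncomputable def freq (α₀ : ℝ) (A T k : ℕ) : ℝ :=
  α₀ * √((k : ℝ) * A * Real.log T / T)

/-- The performance level `T ^ (-γ)`. -/
noncomputable def level (γ : ℝ) (T : ℕ) : ℝ :=
  (T : ℝ) ^ (-γ)

end DAB

/-!
The schedule of forced exploration after a restart is deterministic. Therefore the samples that the
detectors receive, and the rewards left to the bandit algorithm, are read off the reward table along
fixed sequences of times, given the time `s` and the number `k` of the last restart. The event
`restartSet D p k s` that the `k`-th restart occurs at time `s` depends on the rewards up to time `s`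
only, whereas everything that happens until the next restart depends on later rewards. These are
independent, so that, for fixed `s`, the guarantees of the detector and of the bandit algorithm on
independent samples apply, and the sum over the disjoint events `restartSet D p k s` costs nothing
(`PSBandit.sum_integral_restartSet_le`).

Call the `k`-th restart timely if it occurs within the latency after the `k`-th change-point. By the
separation condition, a timely restart is followed by enough exploration before the next change,
hence by a timely restart, except with probability `(A + 1) δ`, where `δ = T ^ (-γ)`
(`PSBandit.Detectable.compl_timelySet_le`). After a timely restart without false alarm, the regret on
an interval of length `n` splits into the delay, the forced exploration, which costs at most
`A (n / p + 1)` rounds for the period `p`, and the regret of the bandit algorithm on at most `n`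
stationary rounds (`PSBandit.Detectable.regret_le`). If the last interval is too short for a detection,
its whole regret counts as delay.

It remains to sum over the intervals (`LargeHorizon.regret_le`). The separation
`√(T log T)` forces `N √(T log T) ≤ T`; for large `T`, this keeps the exploration
frequencies below `1`, and makes `A N` and `N log T` negligible. The delays sum to the required order
because the periods are of order `√(A T / (k log T))` and `∑ 1 / √k ≤ 2 √N`, the exploration because
the frequencies are at most that of index `N + 1`, and the regret of the bandit algorithm by the
Cauchy–Schwarz inequality.
-/

namespace DAB

variable {A T : ℕ}

/-! ### Functions of finitely many coordinates under a product measure -/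

/-- Under a product measure, functions that depend on disjoint finite sets of coordinates are
independent. -/
theorem indepFun_of_dependsOn {X : ℕ → Type*} [∀ i, MeasurableSpace (X i)] [∀ i, Nonempty (X i)]
    (μ : ∀ i, Measure (X i)) [∀ i, IsProbabilityMeasure (μ i)]
    {β γ : Type*} [MeasurableSpace β] [MeasurableSpace γ]
    {f : (∀ i, X i) → β} {g : (∀ i, X i) → γ} {s t : Finset ℕ} (hst : Disjoint s t)
    (hf : Measurable f) (hg : Measurable g)
    (hfs : DependsOn f (s : Set ℕ)) (hgt : DependsOn g (t : Set ℕ)) :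
    IndepFun f g (Measure.infinitePi μ) := by
  classical
  have key := (iIndepFun_infinitePi (P := μ) (X := fun _ x => x)
    (fun _ => measurable_id)).indepFun_finset s t hst (fun i => measurable_pi_apply i)
  -- a finite tuple is extended to a sequence by arbitrary values
  let ext (u : Finset ℕ) (y : ∀ i : u, X i) : ∀ i, X i :=
    fun i => if h : i ∈ u then y ⟨i, h⟩ else Classical.arbitrary _
  have hext (u : Finset ℕ) : Measurable (ext u) := by
    refine measurable_pi_lambda _ fun i => ?_
    by_cases h : i ∈ u
    · simp only [ext, h, dif_pos]; exact measurable_pi_apply _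
    · simp only [ext, h, dif_neg, not_false_eq_true]; exact measurable_const
  have h := key.comp (hf.comp (hext s)) (hg.comp (hext t))
  have hf' : f = (f ∘ ext s) ∘ fun x (i : s) => x i := by
    funext x
    exact hfs fun i hi => by simp [ext, Finset.mem_coe.1 hi]
  have hg' : g = (g ∘ ext t) ∘ fun x (i : t) => x i := by
    funext x
    exact hgt fun i hi => by simp [ext, Finset.mem_coe.1 hi]
  rw [hf', hg']
  exact h

/-- The law of a function of finitely many coordinates depends only on the marginals of these
coordinates. It serves to forget the laws of the rewards beyond the current interval. -/
theorem map_infinitePi_congr {X : ℕ → Type*} [∀ i, MeasurableSpace (X i)] [∀ i, Nonempty (X i)]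
    {μ μ' : ∀ i, Measure (X i)} [∀ i, IsProbabilityMeasure (μ i)]
    [∀ i, IsProbabilityMeasure (μ' i)]
    {β : Type*} [MeasurableSpace β] {f : (∀ i, X i) → β} {s : Finset ℕ}
    (hf : Measurable f) (hfs : DependsOn f (s : Set ℕ)) (h : ∀ i ∈ s, μ i = μ' i) :
    (Measure.infinitePi μ).map f = (Measure.infinitePi μ').map f := by
  classical
  let ext (y : ∀ i : s, X i) : ∀ i, X i :=
    fun i => if h : i ∈ s then y ⟨i, h⟩ else Classical.arbitrary _
  have hext : Measurable ext := by
    refine measurable_pi_lambda _ fun i => ?_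
    by_cases h : i ∈ s
    · simp only [ext, h, dif_pos]; exact measurable_pi_apply _
    · simp only [ext, h, dif_neg, not_false_eq_true]; exact measurable_const
  have hf' : f = (f ∘ ext) ∘ s.restrict := by
    funext x
    exact hfs fun i hi => by simp [ext, Finset.mem_coe.1 hi]
  have hm : Measurable (s.restrict (π := X)) := by fun_prop
  have : (fun i : s => μ i) = fun i : s => μ' i := funext fun i => h i i.2
  rw [hf', ← Measure.map_map (hf.comp hext) hm, ← Measure.map_map (hf.comp hext) hm,
    Measure.infinitePi_map_restrict, Measure.infinitePi_map_restrict, this]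

/-- Along an injective sequence of times, and after a coordinatewise map, independent coordinates
remain independent. -/
theorem map_infinitePi_subsequence {X Y : Type*} [MeasurableSpace X] [MeasurableSpace Y]
    (μ : ℕ → Measure X) [∀ i, IsProbabilityMeasure (μ i)] {g : ℕ → ℕ} (hg : Function.Injective g)
    {φ : X → Y} (hφ : Measurable φ) :
    (Measure.infinitePi μ).map (fun x j => φ (x (g j))) =
      Measure.infinitePi fun j => (μ (g j)).map φ := by
  have h := ((iIndepFun_infinitePi (P := μ) (X := fun _ x => φ x)
    (fun _ => hφ)).precomp hg).map_fun_eq_infinitePi_map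
      (fun j => hφ.comp (measurable_pi_apply (g j)))
  simp only [Function.comp_def] at h
  rw [h]
  congr 1
  funext j
  rw [← Measure.infinitePi_map_eval μ (g j), Measure.map_map hφ (measurable_pi_apply _)]
  rfl

/-- The form in which independence is used: `F` says what happened up to a restart, and `h` is a
function of the rewards after it. -/
theorem integral_indicator_mul_of_dependsOn {X : ℕ → Type*} [∀ i, MeasurableSpace (X i)]
    [∀ i, Nonempty (X i)] (μ : ∀ i, Measure (X i)) [∀ i, IsProbabilityMeasure (μ i)]
    {F : Set (∀ i, X i)} {h : (∀ i, X i) → ℝ} {s t : Finset ℕ} (hst : Disjoint s t)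
    (hF : MeasurableSet F) (hh : Measurable h)
    (hFs : DependsOn (fun x => x ∈ F) (s : Set ℕ)) (hht : DependsOn h (t : Set ℕ)) :
    ∫ x, F.indicator h x ∂(Measure.infinitePi μ) =
      (Measure.infinitePi μ).real F * ∫ x, h x ∂(Measure.infinitePi μ) := by
  classical
  have hind : DependsOn (F.indicator fun _ => (1 : ℝ)) (s : Set ℕ) := fun x y hxy => by
    have : x ∈ F ↔ y ∈ F := iff_of_eq (hFs hxy)
    simp only [Set.indicator_apply, this]
  have hm : Measurable (F.indicator fun _ => (1 : ℝ)) := measurable_const.indicator hF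
  have := (indepFun_of_dependsOn μ hst hm hh hind hht).integral_fun_mul_eq_mul_integral
    hm.aestronglyMeasurable hh.aestronglyMeasurable
  rw [integral_indicator_const _ hF, smul_eq_mul, mul_one] at this
  rw [← this]
  congr 1
  funext x
  by_cases hx : x ∈ F <;> simp [hx]

theorem infinitePi_real_congr {X : ℕ → Type*} [∀ i, MeasurableSpace (X i)] [∀ i, Nonempty (X i)]
    {μ μ' : ∀ i, Measure (X i)} [∀ i, IsProbabilityMeasure (μ i)]
    [∀ i, IsProbabilityMeasure (μ' i)] {S : Set (∀ i, X i)} {s : Finset ℕ}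
    (hS : MeasurableSet S) (hSs : DependsOn (fun x => x ∈ S) (s : Set ℕ))
    (h : ∀ i ∈ s, μ i = μ' i) :
    (Measure.infinitePi μ).real S = (Measure.infinitePi μ').real S := by
  have hm : Measurable fun x => x ∈ S := hS.mem
  have := congrArg (fun m => m.real {True}) (map_infinitePi_congr hm hSs h)
  rw [map_measureReal_apply hm (measurableSet_singleton _),
    map_measureReal_apply hm (measurableSet_singleton _)] at this
  simpa [Set.preimage] using this

/-! ### Episodes between restarts -/

/-- No detector declares a change up to time `t` in the episode that starts after time `s` and has
exploration period `p`. -/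
def IsQuiet (D : ChangeDetector) (p s t : ℕ) (x : ℕ → Fin A → ℝ) : Prop :=
  ∀ (a : Fin A) (j : ℕ), s + 1 + a + p * j ≤ t →
    D.alarm (List.ofFn fun i : Fin (j + 1) => x (s + 1 + a + p * i) a) = false

/-- Some detector declares a change at time `t` in the episode that starts after time `s` and has
exploration period `p`. -/
def AlarmsAt (D : ChangeDetector) (p s t : ℕ) (x : ℕ → Fin A → ℝ) : Prop :=
  ∃ (a : Fin A) (j : ℕ), s + 1 + a + p * j = t ∧
    D.alarm (List.ofFn fun i : Fin (j + 1) => x (s + 1 + a + p * i) a) = true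

/-- The reward tables on which the `k`-th restart occurs at time `s` (where the start of the
procedure counts as restart `0`); the episode that follows has exploration period `p (k + 1)`. -/
def restartSet (D : ChangeDetector) (p : ℕ → ℕ) : ℕ → ℕ → Set (ℕ → Fin A → ℝ)
  | 0, s => {_x | s = 0}
  | k + 1, t => {x | ∃ s < t, x ∈ restartSet D p k s ∧ IsQuiet D (p (k + 1)) s (t - 1) x ∧
      AlarmsAt D (p (k + 1)) s t x}

/-- The rewards of the rounds left to the bandit algorithm, in the episode that starts after time `s`
and has exploration period `p`. -/
noncomputable def banditTable (p s : ℕ) (x : ℕ → Fin A → ℝ) : ℕ → Fin A → ℝ :=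
  fun i => x (s + 1 + Nat.nth (fun v => A ≤ v % p) i)

theorem IsQuiet.mono {D : ChangeDetector} {p s t t' : ℕ} {x : ℕ → Fin A → ℝ} (h : t ≤ t')
    (hx : IsQuiet D p s t' x) : IsQuiet D p s t x :=
  fun a j hj => hx a j (hj.trans h)

theorem isQuiet_self {D : ChangeDetector} {p s : ℕ} {x : ℕ → Fin A → ℝ} : IsQuiet D p s s x :=
  fun a j hj => by omega

/-- The round of position `a` in a cycle that comes `u` rounds after the restart is preceded, since the
restart, by `u / p` rounds of the same position. -/
theorem count_mod_eq {p a u : ℕ} (hu : u % p = a) : Nat.count (fun v => v % p = a) u = u / p := by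
  rcases Nat.eq_zero_or_pos p with rfl | hp
  · simp only [Nat.mod_zero] at hu ⊢
    subst hu
    simp [Nat.count_eq_card_filter_range, Finset.filter_eq']
  · have h := Nat.count_modEq_card (b := u) (v := a) hp
    have ha : a % p = a := by rw [← hu, Nat.mod_mod]
    simp only [Nat.ModEq, ha, hu, lt_irrefl, if_false, add_zero] at h
    exact h

/-- State of the procedure `u` rounds after a restart at time `s` that led to interval index `k`, as
long as no detector has declared a change. -/
noncomputable def episodeState (B : BanditAlg A) (p k s u : ℕ) (x : ℕ → Fin A → ℝ) : State A :=
  ⟨s, k, fun a => List.ofFn fun i : Fin (Nat.count (fun v => v % p = a) u) =>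
      x (s + 1 + a + p * i) a,
    B.history (banditTable p s x) (Nat.count (fun v => A ≤ v % p) u)⟩

theorem phase_episodeState (B : BanditAlg A) (α : ℕ → ℝ) (k s u : ℕ) (x : ℕ → Fin A → ℝ) :
    (episodeState B (period A α k) k s u x).phase α (s + u + 1) = u % period A α k := by
  rw [State.phase, episodeState]
  congr 1
  simp only
  omega

theorem arm_episodeState (B : BanditAlg A) (α : ℕ → ℝ) (k s u : ℕ) (x : ℕ → Fin A → ℝ) :
    (episodeState B (period A α k) k s u x).arm B α (s + u + 1) =
      if h : u % period A α k < A then ⟨u % period A α k, h⟩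
      else B.act (B.history (banditTable (period A α k) s x)
        (Nat.count (fun v => A ≤ v % period A α k) u)) := by
  simp only [State.arm, phase_episodeState]
  rfl

/-- The samples on which a detector is run in a round of forced exploration. -/
theorem histD_episodeState (B : BanditAlg A) (p k s u : ℕ) (x : ℕ → Fin A → ℝ) (hu : u % p < A) :
    (episodeState B p k s u x).histD ⟨u % p, hu⟩ ++ [x (s + u + 1) ⟨u % p, hu⟩] =
      List.ofFn fun i : Fin (u / p + 1) => x (s + 1 + u % p + p * i) ⟨u % p, hu⟩ := by
  have htime : s + u + 1 = s + 1 + u % p + p * (u / p) := by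
    have := Nat.mod_add_div u p
    omega
  rw [episodeState, List.ofFn_succ_last]
  simp only [count_mod_eq rfl, Fin.val_castSucc, Fin.val_last, ← htime, Fin.val_cast]

theorem state_eq_of_isQuiet (B : BanditAlg A) (D : ChangeDetector) (α : ℕ → ℝ)
    {x : ℕ → Fin A → ℝ} {k s : ℕ} (hs : state B D α x s = ⟨s, k, fun _ => [], []⟩) (u : ℕ)
    (hq : IsQuiet D (period A α k) s (s + u) x) :
    state B D α x (s + u) = episodeState B (period A α k) k s u x := by
  induction u with
  | zero => simpa [BanditAlg.history, episodeState] using hs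
  | succ u ih =>
    rw [← add_assoc, state, ih (hq.mono (by omega)), State.step, phase_episodeState,
      arm_episodeState]
    set p := period A α k with hp
    by_cases hu : u % p < A
    · have hal := hq ⟨u % p, hu⟩ (u / p) (by
        have := Nat.mod_add_div u p
        simp only; omega)
      simp only [hu, if_true, dif_pos, histD_episodeState, hal, Bool.false_eq_true, if_false]
      simp only [episodeState, State.mk.injEq, true_and]
      refine ⟨?_, ?_⟩
      · funext a
        by_cases ha : a = ⟨u % p, hu⟩
        · subst ha
          simp only [Function.update_self, Nat.count_succ, if_true, count_mod_eq rfl, Fin.val_cast]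
        · have ha' : ¬ u % p = a := fun h => ha (Fin.ext h.symm)
          simp only [Function.update_of_ne ha, Nat.count_succ, ha', if_false, add_zero,
            Fin.val_cast]
      · simp [Nat.count_succ, not_le.2 hu]
    · simp only [hu, if_false, dif_neg, not_false_eq_true]
      simp only [episodeState, State.mk.injEq, true_and]
      refine ⟨?_, ?_⟩
      · funext a
        have ha' : ¬ u % p = a := fun h => hu (h ▸ a.2)
        simp only [Nat.count_succ, ha', if_false, add_zero, Fin.val_cast]
      · have hn : Nat.nth (fun v => A ≤ v % p) (Nat.count (fun v => A ≤ v % p) u) = u :=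
          Nat.nth_count (p := fun v => A ≤ v % p) (not_lt.1 hu)
        simp only [Nat.count_succ, not_lt.1 hu, if_true, BanditAlg.history, banditTable, hn]
        rw [add_right_comm]

/-- On `restartSet`, the procedure does restart; in particular the bandit algorithm has no influence
on the times of the restarts. The periods have to be at least `A`, so that all arms are explored. -/
theorem state_of_mem_restartSet (B : BanditAlg A) (D : ChangeDetector) (α : ℕ → ℝ)
    {x : ℕ → Fin A → ℝ} {k s : ℕ} (hα : ∀ j < k, A ≤ period A α (j + 1))
    (hx : x ∈ restartSet D (period A α) k s) :
    state B D α x s = ⟨s, k + 1, fun _ => [], []⟩ := by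
  induction k generalizing s with
  | zero =>
    obtain rfl : s = 0 := hx
    rfl
  | succ k ih =>
    obtain ⟨s', hs', hx', hq, a, j, rfl, hal⟩ := hx
    have hs := ih (fun j hj => hα j (by omega)) hx'
    have hu : ((a : ℕ) + period A α (k + 1) * j) % period A α (k + 1) = a := by
      rw [Nat.add_mul_mod_self_left, Nat.mod_eq_of_lt (a.2.trans_le (hα k (by omega)))]
    have hpp : 0 < period A α (k + 1) := (a.pos).trans_le (hα k (by omega))
    have hv : ((a : ℕ) + period A α (k + 1) * j) / period A α (k + 1) = j := by
      rw [Nat.add_mul_div_left _ _ hpp,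
        Nat.div_eq_of_lt (a.2.trans_le (hα k (by omega))), zero_add]
    have htime : s' + 1 + a + period A α (k + 1) * j =
      s' + (a + period A α (k + 1) * j) + 1 := by omega
    generalize hu' : (a : ℕ) + period A α (k + 1) * j = u at *
    rw [htime] at hq ⊢
    rw [state, state_eq_of_isQuiet B D α hs u hq, State.step, phase_episodeState,
      arm_episodeState]
    have hlt : u % period A α (k + 1) < A := hu ▸ a.2
    have hlist := histD_episodeState B (period A α (k + 1)) (k + 1) s' u x hlt
    simp only [hlt, if_true, dif_pos, hlist]
    simp only [hu, hv, Fin.val_cast, Fin.eta, hal, if_true]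
    rfl

/-- The `k`-th restart occurs at most once. -/
theorem eq_of_mem_restartSet {D : ChangeDetector} {p : ℕ → ℕ} {x : ℕ → Fin A → ℝ} {k s t : ℕ}
    (hs : x ∈ restartSet D p k s) (ht : x ∈ restartSet D p k t) : s = t := by
  induction k generalizing s t with
  | zero => exact (show s = 0 from hs).trans (show t = 0 from ht).symm
  | succ k ih =>
    obtain ⟨s', hs', hx, hq, a, j, rfl, hal⟩ := hs
    obtain ⟨t', ht', hx', hq', a', j', rfl, hal'⟩ := ht
    obtain rfl := ih hx hx'
    by_contra hne
    rcases lt_or_gt_of_ne hne with h | h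
    · exact Bool.false_ne_true ((hq' a j (by omega)).symm.trans hal)
    · exact Bool.false_ne_true ((hq a' j' (by omega)).symm.trans hal')

/-- An episode that is quiet up to time `b` but not up to time `c` ends with a restart between
them. -/
theorem exists_mem_restartSet_succ {D : ChangeDetector} {p : ℕ → ℕ} {x : ℕ → Fin A → ℝ}
    {k s b c : ℕ} (hx : x ∈ restartSet D p k s) (hb : IsQuiet D (p (k + 1)) s b x)
    (hc : ¬ IsQuiet D (p (k + 1)) s c x) :
    ∃ t, b < t ∧ t ≤ c ∧ x ∈ restartSet D p (k + 1) t := by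
  classical
  have hex : ∃ t, ¬ IsQuiet D (p (k + 1)) s t x := ⟨c, hc⟩
  have hfind := Nat.find_spec hex
  have hle : Nat.find hex ≤ c := Nat.find_min' hex hc
  have hmin : ∀ t < Nat.find hex, IsQuiet D (p (k + 1)) s t x := fun t ht =>
    not_not.1 (Nat.find_min hex ht)
  generalize Nat.find hex = t at hfind hle hmin
  have hbt : b < t := by
    by_contra h
    exact hfind (hb.mono (not_lt.1 h))
  have hst : s < t := by
    by_contra h
    exact hfind (isQuiet_self.mono (not_lt.1 h))
  have hq : IsQuiet D (p (k + 1)) s (t - 1) x := hmin _ (by omega)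
  refine ⟨t, hbt, hle, s, hst, hx, hq, ?_⟩
  by_contra hno
  refine hfind fun a j hj => ?_
  rcases hj.lt_or_eq with h | h
  · exact hq a j (by omega)
  · by_contra hal
    exact hno ⟨a, j, h, by simpa using hal⟩

/-- Number of rounds of forced exploration among the first `L` rounds of an episode. -/
theorem count_mod_lt_le {p : ℕ} (hp : 0 < p) (L : ℕ) :
    Nat.count (fun v => v % p < A) L ≤ A * (L / p + 1) := by
  have hA : Nat.count (fun v => v % p < A) p ≤ A := by
    rw [Nat.count_eq_card_filter_range]
    refine (Finset.card_le_card (t := Finset.range A) fun v hv => ?_).trans (by simp)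
    simp only [Finset.mem_filter, Finset.mem_range] at hv ⊢
    rw [Nat.mod_eq_of_lt hv.1] at hv
    exact hv.2
  have hq : ∀ q, Nat.count (fun v => v % p < A) (p * q) ≤ A * q := by
    intro q
    induction q with
    | zero => simp
    | succ q ih =>
      rw [mul_add_one, Nat.count_add, mul_add_one]
      simpa only [Nat.mul_add_mod] using add_le_add ih hA
  refine (Nat.count_monotone _ ?_).trans (hq _)
  have := Nat.mod_add_div L p
  have := Nat.mod_lt L hp
  rw [mul_add_one]
  omega

/-- Regret of a quiet episode: apart from forced exploration, it is the regret of the bandit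
algorithm on its own reward table. -/
theorem sum_range_episode_le (g : Fin A → ℝ) {C : ℝ} (hgC : ∀ a, g a ≤ C)
    (B : BanditAlg A) (D : ChangeDetector) (α : ℕ → ℝ)
    {x : ℕ → Fin A → ℝ} {k s L : ℕ} (hs : state B D α x s = ⟨s, k, fun _ => [], []⟩)
    (hp : 0 < period A α k) (hC : 0 ≤ C) (hq : IsQuiet D (period A α k) s (s + L) x) :
    ∑ u ∈ Finset.range L, g (action B D α x (s + u + 1)) ≤
      C * (A * (L / period A α k + 1)) +
        ∑ i ∈ Finset.range (Nat.count (fun v => A ≤ v % period A α k) L),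
          g (B.act (B.history (banditTable (period A α k) s x) i)) := by
  set p := period A α k with hpd
  set f : ℕ → ℝ := fun i => g (B.act (B.history (banditTable p s x) i)) with hf
  have hsplit : ∑ u ∈ Finset.range L, g (action B D α x (s + u + 1)) ≤
      C * Nat.count (fun v => v % p < A) L +
        ∑ i ∈ Finset.range (Nat.count (fun v => A ≤ v % p) L), f i := by
    induction L with
    | zero => simp
    | succ L ih =>
      have ih := ih (hq.mono (by omega))
      have hact : action B D α x (s + L + 1) =
          (episodeState B p k s L x).arm B α (s + L + 1) := by
        rw [action, Nat.add_sub_cancel, state_eq_of_isQuiet B D α hs L (hq.mono (by omega))]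
      rw [Finset.sum_range_succ, hact, arm_episodeState, ← hpd, Nat.count_succ, Nat.count_succ]
      by_cases hL : L % p < A
      · simp only [hL, dif_pos, if_true, not_le.2 hL, if_false, add_zero, Nat.cast_add,
          Nat.cast_one]
        linarith [hgC ⟨L % p, hL⟩]
      · simp only [hL, dif_neg, not_false_eq_true, if_false, add_zero, not_lt.1 hL, if_true,
          Finset.sum_range_succ]
        linarith
  refine hsplit.trans (add_le_add (mul_le_mul_of_nonneg_left ?_ hC) le_rfl)
  · have h1 : (Nat.count (fun v => v % p < A) L : ℝ) ≤ (A : ℝ) * ((L / p : ℕ) + 1) := by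
      exact_mod_cast count_mod_lt_le hp L
    refine h1.trans (mul_le_mul_of_nonneg_left ?_ (Nat.cast_nonneg _))
    have := @Nat.cast_div_le ℝ _ _ _ L p
    linarith

/-! ### Measurability, and the rewards that determine an event -/

theorem measurableSet_isQuiet (D : ChangeDetector) (p s t : ℕ) :
    MeasurableSet {x : ℕ → Fin A → ℝ | IsQuiet D p s t x} := by
  simp only [IsQuiet, Set.ofPred_forall]
  refine MeasurableSet.iInter fun a => MeasurableSet.iInter fun j => MeasurableSet.iInter fun _ => ?_
  have : Measurable fun x : ℕ → Fin A → ℝ => fun i : Fin (j + 1) => x (s + 1 + a + p * i) a := by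
    fun_prop
  exact ((D.measurable_alarm (j + 1)).comp this) (measurableSet_singleton false)

theorem measurableSet_alarmsAt (D : ChangeDetector) (p s t : ℕ) :
    MeasurableSet {x : ℕ → Fin A → ℝ | AlarmsAt D p s t x} := by
  simp only [AlarmsAt, Set.ofPred_exists, Set.ofPred_and]
  refine MeasurableSet.iUnion fun a => MeasurableSet.iUnion fun j =>
    (MeasurableSet.const _).inter ?_
  have : Measurable fun x : ℕ → Fin A → ℝ => fun i : Fin (j + 1) => x (s + 1 + a + p * i) a := by
    fun_prop
  exact ((D.measurable_alarm (j + 1)).comp this) (measurableSet_singleton true)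

theorem measurableSet_restartSet (D : ChangeDetector) (p : ℕ → ℕ) (k s : ℕ) :
    MeasurableSet (restartSet (A := A) D p k s) := by
  induction k generalizing s with
  | zero => exact MeasurableSet.const _
  | succ k ih =>
    simp only [restartSet, Set.ofPred_exists, Set.ofPred_and]
    exact MeasurableSet.iUnion fun s' => (MeasurableSet.const _).inter ((ih s').inter
      ((measurableSet_isQuiet D _ s' _).inter (measurableSet_alarmsAt D _ s' s)))

theorem isQuiet_congr {D : ChangeDetector} {p s t : ℕ} {x y : ℕ → Fin A → ℝ}
    (h : ∀ i ∈ Finset.Ioc s t, x i = y i) : IsQuiet D p s t x ↔ IsQuiet D p s t y := by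
  refine forall_congr' fun a => forall_congr' fun j => forall_congr' fun hj => ?_
  have : ∀ i : Fin (j + 1), x (s + 1 + a + p * i) = y (s + 1 + a + p * i) := fun i =>
    h _ (Finset.mem_Ioc.2 ⟨by omega, by
      have := Nat.mul_le_mul_left p (Nat.lt_succ_iff.1 i.2)
      omega⟩)
  simp only [this]

theorem alarmsAt_congr {D : ChangeDetector} {p s t : ℕ} {x y : ℕ → Fin A → ℝ}
    (h : ∀ i ∈ Finset.Ioc s t, x i = y i) : AlarmsAt D p s t x ↔ AlarmsAt D p s t y := by
  refine exists_congr fun a => exists_congr fun j => and_congr_right fun hj => ?_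
  have : ∀ i : Fin (j + 1), x (s + 1 + a + p * i) = y (s + 1 + a + p * i) := fun i =>
    h _ (Finset.mem_Ioc.2 ⟨by omega, by
      have := Nat.mul_le_mul_left p (Nat.lt_succ_iff.1 i.2)
      omega⟩)
  simp only [this]

/-- Whether the `k`-th restart occurs at time `s` is decided by the rewards up to time `s`. -/
theorem dependsOn_mem_restartSet (D : ChangeDetector) (p : ℕ → ℕ) (k s : ℕ) :
    DependsOn (fun x : ℕ → Fin A → ℝ => x ∈ restartSet D p k s) (Finset.Iic s : Set ℕ) := by
  induction k generalizing s with
  | zero => exact fun x y _ => rfl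
  | succ k ih =>
    intro x y hxy
    simp only [Finset.mem_coe, Finset.mem_Iic] at hxy
    refine propext (exists_congr fun s' => and_congr_right fun hs' => and_congr ?_ (and_congr ?_ ?_))
    · exact iff_of_eq (ih s' fun i hi => hxy i (by simp at hi; omega))
    · exact isQuiet_congr fun i hi => hxy i (by simp at hi; omega)
    · exact alarmsAt_congr fun i hi => hxy i (by simp at hi; omega)

theorem BanditAlg.exists_measurable_history (B : BanditAlg A) (n : ℕ) :
    ∃ h : (ℕ → Fin A → ℝ) → Fin n → Fin A × ℝ, Measurable h ∧
      ∀ x, B.history x n = List.ofFn (h x) := by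
  induction n with
  | zero => exact ⟨fun _ i => i.elim0, measurable_pi_lambda _ fun i => i.elim0, fun x => rfl⟩
  | succ n ih =>
    obtain ⟨h, hm, hh⟩ := ih
    have hact : Measurable fun x => B.act (List.ofFn (h x)) := (B.measurable_act n).comp hm
    have hrew : Measurable fun x : ℕ → Fin A → ℝ => x n (B.act (List.ofFn (h x))) := by
      have he : Measurable fun q : Fin A × (ℕ → Fin A → ℝ) => q.2 n q.1 :=
        measurable_from_prod_countable_right fun a =>
          (measurable_pi_apply a).comp (measurable_pi_apply n)
      exact he.comp (hact.prodMk measurable_id)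
    refine ⟨fun x => Fin.snoc (α := fun _ => Fin A × ℝ) (h x)
      (B.act (List.ofFn (h x)), x n (B.act (List.ofFn (h x)))), ?_, fun x => ?_⟩
    · refine measurable_pi_lambda _ fun i => ?_
      refine Fin.lastCases ?_ (fun j => ?_) i
      · simp only [Fin.snoc_last]
        exact hact.prodMk hrew
      · simp only [Fin.snoc_castSucc]
        exact (measurable_pi_apply j).comp hm
    · rw [history, hh, List.ofFn_succ_last]
      simp

theorem BanditAlg.measurable_act_history (B : BanditAlg A) (n : ℕ) :
    Measurable fun x : ℕ → Fin A → ℝ => B.act (B.history x n) := by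
  obtain ⟨h, hm, hh⟩ := B.exists_measurable_history n
  simp only [hh]
  exact (B.measurable_act n).comp hm

theorem BanditAlg.history_congr (B : BanditAlg A) {n : ℕ} {x y : ℕ → Fin A → ℝ}
    (h : ∀ i < n, x i = y i) : B.history x n = B.history y n := by
  induction n with
  | zero => rfl
  | succ n ih =>
    rw [history, history, ih fun i hi => h i (by omega), h n (by omega)]

/-- Cumulative loss of the algorithm over `n` rounds, for the loss `g` of the arms. -/
noncomputable def BanditAlg.loss (B : BanditAlg A) (g : Fin A → ℝ) (n : ℕ)
    (x : ℕ → Fin A → ℝ) : ℝ :=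
  ∑ i ∈ Finset.range n, g (B.act (B.history x i))

theorem BanditAlg.measurable_loss (B : BanditAlg A) (g : Fin A → ℝ) (n : ℕ) :
    Measurable (B.loss g n) :=
  Finset.measurable_sum _ fun i _ => (Measurable.of_discrete (f := g)).comp
    (B.measurable_act_history i)

theorem BanditAlg.dependsOn_loss (B : BanditAlg A) (g : Fin A → ℝ) (n : ℕ) :
    DependsOn (B.loss g n) (Finset.range n : Set ℕ) := fun x y hxy =>
  Finset.sum_congr rfl fun i hi => by
    rw [B.history_congr fun j hj => hxy j (by
      simp only [Finset.coe_range, Set.mem_Iio, Finset.mem_range] at hi ⊢; omega)]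

theorem BanditAlg.loss_nonneg (B : BanditAlg A) {g : Fin A → ℝ} (hg : ∀ a, 0 ≤ g a) (n : ℕ)
    (x : ℕ → Fin A → ℝ) : 0 ≤ B.loss g n x :=
  Finset.sum_nonneg fun _ _ => hg _

theorem BanditAlg.integrable_loss (B : BanditAlg A) (g : Fin A → ℝ) (n : ℕ)
    {Ω : Type*} [MeasurableSpace Ω] (μ : Measure Ω) [IsProbabilityMeasure μ]
    {f : Ω → ℕ → Fin A → ℝ} (hf : Measurable f) : Integrable (fun x => B.loss g n (f x)) μ := by
  have hb : ∀ a, |g a| ≤ ∑ b, |g b| := fun a =>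
    Finset.single_le_sum (f := fun b => |g b|) (fun b _ => abs_nonneg _) (Finset.mem_univ a)
  refine Integrable.of_bound ((B.measurable_loss g n).comp hf).aestronglyMeasurable
    (n * ∑ b, |g b|) (ae_of_all _ fun x => ?_)
  refine (Finset.abs_sum_le_sum_abs _ _).trans ?_
  simpa using Finset.sum_le_card_nsmul (Finset.range n) _ _ fun i _ =>
    hb (B.act (B.history (f x) i))

theorem gap_nonneg (P : Fin A → ProbabilityMeasure ℝ) (a : Fin A) : 0 ≤ gap P a :=
  sub_nonneg.2 (le_ciSup (f := fun b => mean (P b)) (Set.finite_range _).bddAbove a)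

theorem BanditAlg.regret_mono (B : BanditAlg A) (P : Fin A → ProbabilityMeasure ℝ) {n n' : ℕ}
    (h : n ≤ n') : B.regret P n ≤ B.regret P n' := by
  refine integral_mono (B.integrable_loss _ n _ measurable_id)
    (B.integrable_loss _ n' _ measurable_id) fun x => ?_
  exact Finset.sum_le_sum_of_subset_of_nonneg (Finset.range_subset_range.2 h)
    fun i _ _ => gap_nonneg _ _

/-! ### False alarms and missed detections -/

/-- The sequences on which the detector declares no change within the first `J` samples. -/
def ChangeDetector.silentSet (D : ChangeDetector) (J : ℕ) : Set (ℕ → ℝ) :=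
  {y | ∀ j < J, D.alarm (List.ofFn fun i : Fin (j + 1) => y i) = false}

theorem ChangeDetector.measurableSet_silentSet (D : ChangeDetector) (J : ℕ) :
    MeasurableSet (D.silentSet J) := by
  simp only [silentSet, Set.ofPred_forall]
  refine MeasurableSet.iInter fun j => MeasurableSet.iInter fun _ => ?_
  have : Measurable fun y : ℕ → ℝ => fun i : Fin (j + 1) => y i := by fun_prop
  exact ((D.measurable_alarm (j + 1)).comp this) (measurableSet_singleton false)

theorem ChangeDetector.dependsOn_mem_silentSet (D : ChangeDetector) (J : ℕ) :
    DependsOn (fun y => y ∈ D.silentSet J) (Finset.range J : Set ℕ) := by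
  intro x y hxy
  simp only [Finset.coe_range, Set.mem_Iio] at hxy
  refine propext (forall_congr' fun j => forall_congr' fun hj => ?_)
  have : ∀ i : Fin (j + 1), x i = y i := fun i => hxy i (by omega)
  simp only [this]

theorem ChangeDetector.silentSet_subset (D : ChangeDetector) (J : ℕ) :
    D.silentSet J ⊆ {y | ((J + 1 : ℕ) : ℕ∞) ≤ D.stoppingTime y} := by
  intro y hy
  refine le_sInf (α := ℕ∞) ?_
  rintro _ ⟨n, hn, hal, rfl⟩
  obtain ⟨j, rfl⟩ : ∃ j, n = j + 1 := ⟨n - 1, by omega⟩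
  by_contra hlt
  have hj : j < J := by
    have := Nat.cast_lt.1 (not_le.1 hlt)
    omega
  exact Bool.false_ne_true ((hy j hj).symm.trans hal)

theorem ChangeDetector.compl_silentSet_subset (D : ChangeDetector) {J M : ℕ} (h : J ≤ M) :
    (D.silentSet J)ᶜ ⊆ {y | D.stoppingTime y ≤ (M : ℕ∞)} := by
  intro y hy
  simp only [silentSet, Set.mem_compl_iff, Set.mem_ofPred_eq, not_forall, exists_prop,
    Bool.not_eq_false] at hy
  obtain ⟨j, hj, hal⟩ := hy
  refine (sInf_le ⟨j + 1, by omega, hal, rfl⟩ : D.stoppingTime y ≤ ((j + 1 : ℕ) : ℕ∞)).trans ?_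
  exact_mod_cast (by omega : j + 1 ≤ M)

/-- The samples of an arm that an episode collects up to time `t` form an initial segment. -/
theorem exists_sample_count {p : ℕ} (hp : 0 < p) (c t : ℕ) :
    ∃ J, ∀ j, c + p * j ≤ t ↔ j < J := by
  classical
  have hex : ∃ j, t < c + p * j := ⟨t + 1, by nlinarith⟩
  refine ⟨Nat.find hex, fun j => ⟨fun h => ?_, fun h => not_lt.1 (Nat.find_min hex h)⟩⟩
  by_contra hj
  have h1 := Nat.find_spec hex
  have := Nat.mul_le_mul_left p (not_lt.1 hj)
  omega

/-- The rewards of forced exploration of arm `a`, in the episode that starts after time `s` and has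
exploration period `p`. -/
def explored (p s : ℕ) (a : Fin A) (x : ℕ → Fin A → ℝ) : ℕ → ℝ :=
  fun i => x (s + 1 + a + p * i) a

theorem measurable_explored (p s : ℕ) (a : Fin A) : Measurable (explored p s a) := by
  unfold explored
  fun_prop

instance (f₀ f₁ : ProbabilityMeasure ℝ) (ν : ℕ∞) : IsProbabilityMeasure (changeLaw f₀ f₁ ν) := by
  unfold changeLaw
  infer_instance

namespace PSBandit

variable (E : PSBandit A T)

theorem ν_mono {i j : ℕ} (hij : i ≤ j) (hj : j ≤ E.N + 1) : E.ν i ≤ E.ν j := by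
  induction j, hij using Nat.le_induction with
  | base => exact le_rfl
  | succ j hij ih => exact (ih (by omega)).trans (E.ν_lt j (by omega)).le

theorem one_le_ν {k : ℕ} (hk : k ≤ E.N + 1) : 1 ≤ E.ν k := by
  have := E.ν_mono (Nat.zero_le k) hk
  rwa [E.ν_zero] at this

theorem ν_le {k : ℕ} (hk : k ≤ E.N + 1) : E.ν k ≤ T + 1 := by
  have := E.ν_mono hk le_rfl
  rwa [E.ν_last] at this

theorem interval_eq {k t : ℕ} (hk : k ≤ E.N) (h : E.ν k ≤ t) (h' : t < E.ν (k + 1)) :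
    E.interval t = k + 1 := by
  have : (Finset.range (E.N + 1)).filter (fun j => E.ν j ≤ t) = Finset.range (k + 1) := by
    ext j
    simp only [Finset.mem_filter, Finset.mem_range]
    constructor
    · rintro ⟨hj, hjt⟩
      by_contra hkj
      have := E.ν_mono (show k + 1 ≤ j by omega) (by omega)
      omega
    · intro hj
      exact ⟨by omega, (E.ν_mono (show j ≤ k by omega) (by omega)).trans h⟩
  rw [interval, this, Finset.card_range]

instance : IsProbabilityMeasure E.rewardLaw := by
  unfold rewardLaw
  infer_instance

theorem map_explored {p : ℕ} (hp : 0 < p) (s : ℕ) (a : Fin A) :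
    E.rewardLaw.map (explored p s a) =
      Measure.infinitePi fun j => (E.law (E.interval (s + 1 + a + p * j)) a : Measure ℝ) := by
  have hinj : Function.Injective fun j => s + 1 + (a : ℕ) + p * j := fun i j hij =>
    Nat.eq_of_mul_eq_mul_left hp (Nat.add_left_cancel hij)
  have h := map_infinitePi_subsequence
    (fun t : ℕ => Measure.pi fun b => (E.law (E.interval t) b : Measure ℝ)) hinj
    (measurable_pi_apply a)
  refine h.trans ?_
  congr 1
  funext j
  exact (measurePreserving_eval _ a).map_eq

/-- An episode whose first round is at `ν k` or later raises a false alarm before `ν (k + 1)` with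
probability at most `A δF`: each detector sees identically distributed samples, no more of them than
the horizon. -/
theorem not_isQuiet_le {D : ChangeDetector} {σ : ℝ≥0} {δF : ℝ} {p k s t : ℕ} (hp : 0 < p)
    (hD : ∀ f : ProbabilityMeasure ℝ, IsSubGaussian σ f →
      (changeLaw f f ⊤).real {x | D.stoppingTime x ≤ (T : ℕ∞)} ≤ δF)
    (hk : k ≤ E.N) (hlaw : ∀ a, IsSubGaussian σ (E.law (k + 1) a))
    (hs : E.ν k ≤ s + 1) (ht : t < E.ν (k + 1)) :
    E.rewardLaw.real {x | ¬ IsQuiet D p s t x} ≤ A * δF := by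
  choose J hJ using fun a : Fin A => exists_sample_count hp (s + 1 + a) t
  have hsub : {x | ¬ IsQuiet D p s t x} ⊆
      ⋃ a, explored p s a ⁻¹' (D.silentSet (J a))ᶜ := by
    intro x hx
    by_contra hno
    simp only [Set.mem_iUnion, not_exists, Set.mem_preimage, Set.mem_compl_iff, not_not] at hno
    exact hx fun a j hj => hno a j ((hJ a j).1 hj)
  refine (measureReal_mono hsub).trans ((measureReal_iUnion_fintype_le _).trans ?_)
  have hone : ∀ a, E.rewardLaw.real (explored p s a ⁻¹' (D.silentSet (J a))ᶜ) ≤ δF := by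
    intro a
    have hm := D.measurableSet_silentSet (J a)
    rw [← map_measureReal_apply (measurable_explored p s a) hm.compl, E.map_explored hp]
    have hJT : J a ≤ T := by
      by_contra h
      have h1 := (hJ a T).2 (by omega)
      have h2 := E.ν_le (show k + 1 ≤ E.N + 1 by omega)
      have h3 := E.ν_lt k hk
      nlinarith
    refine le_trans (le_of_eq ?_) ((measureReal_mono (D.compl_silentSet_subset hJT)).trans
      (hD (E.law (k + 1) a) (hlaw a)))
    refine infinitePi_real_congr hm.compl (s := Finset.range (J a)) ?_ fun j hj => ?_
    · intro x y hxy
      exact congrArg Not (D.dependsOn_mem_silentSet (J a) hxy)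
    · have := (hJ a j).2 (Finset.mem_range.1 hj)
      rw [E.interval_eq hk (by omega) (by omega)]
      simp
  simpa using Finset.sum_le_card_nsmul Finset.univ _ δF fun a _ => hone a

/-- Missed detection: an arm whose mean shifts enough at `ν (k + 1)` collects at least `m` samples
before the change, because `p * m` rounds precede it, and at least `l` samples within the `p * d`
rounds that follow it. No other change occurs among these rounds, so the samples follow a
`changeLaw`. -/
theorem isQuiet_le {D : ChangeDetector} {δD : ℝ} {p k s m d l : ℕ} {a : Fin A} (hAp : A ≤ p)
    (hp : 1 < p) (hT : 3 ≤ T) (hl : 1 ≤ l) (hld : l ≤ d)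
    (hD : ∀ ν : ℕ, m + 1 ≤ ν → ν ≤ T - l →
      (changeLaw (E.law (k + 1) a) (E.law (k + 2) a) ν).real
        {x | ((ν + l : ℕ) : ℕ∞) ≤ D.stoppingTime x} ≤ δD)
    (hk : k + 1 ≤ E.N) (hs : E.ν k ≤ s + 1) (hs' : s + p * m < E.ν (k + 1))
    (hd : E.ν (k + 1) + p * d ≤ E.ν (k + 2)) :
    E.rewardLaw.real {x | IsQuiet D p s (E.ν (k + 1) + p * d - 1) x} ≤ δD := by
  obtain ⟨J, hJ⟩ := exists_sample_count (show 0 < p by omega) (s + 1 + a) (E.ν (k + 1) - 1)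
  have ha := a.2
  have hν := E.one_le_ν (show k + 1 ≤ E.N + 1 by omega)
  have hmJ : m ≤ J := by
    rcases Nat.eq_zero_or_pos m with rfl | hm
    · exact Nat.zero_le _
    obtain ⟨m', rfl⟩ : ∃ m', m = m' + 1 := ⟨m - 1, by omega⟩
    have := (hJ m').1 (by rw [mul_add_one] at hs'; omega)
    omega
  have htime : s + 1 + a + p * (J + l - 1) ≤ E.ν (k + 1) + p * l - 1 := by
    obtain ⟨l', rfl⟩ : ∃ l', l = l' + 1 := ⟨l - 1, by omega⟩
    rw [show J + (l' + 1) - 1 = J + l' by omega, mul_add, mul_add_one]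
    rcases Nat.eq_zero_or_pos J with h0 | hJ0
    · subst h0
      omega
    · have := (hJ (J - 1)).2 (by omega)
      obtain ⟨J', rfl⟩ : ∃ J', J = J' + 1 := ⟨J - 1, by omega⟩
      rw [mul_add_one]
      simp only [Nat.add_sub_cancel] at this
      omega
  have hpl : p * l ≤ p * d := Nat.mul_le_mul_left p hld
  have hsub : {x | IsQuiet D p s (E.ν (k + 1) + p * d - 1) x} ⊆
      explored p s a ⁻¹' D.silentSet (J + l) := by
    intro x hx j hj
    refine hx a j ?_
    have := Nat.mul_le_mul_left p (show j ≤ J + l - 1 by omega)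
    omega
  have hm := D.measurableSet_silentSet (J + l)
  have hT' := E.ν_le (show k + 2 ≤ E.N + 1 by omega)
  -- a period of at least two rounds leaves room for one more sample within the horizon
  have hJT : J + 1 ≤ T - l := by
    have : 2 * (J + l - 1) ≤ p * (J + l - 1) := Nat.mul_le_mul_right _ hp
    omega
  refine (measureReal_mono hsub).trans ?_
  rw [← map_measureReal_apply (measurable_explored p s a) hm, E.map_explored (by omega)]
  have hD := hD (J + 1) (by omega) hJT
  rw [show J + 1 + l = J + l + 1 by omega] at hD
  refine le_trans (le_of_eq ?_) ((measureReal_mono (D.silentSet_subset (J + l))).trans hD)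
  · refine infinitePi_real_congr hm (D.dependsOn_mem_silentSet (J + l)) fun j hj => ?_
    have hj := Finset.mem_range.1 hj
    by_cases hjJ : j < J
    · have := (hJ j).2 hjJ
      rw [E.interval_eq (k := k) (by omega) (by omega) (by omega), if_pos]
      exact_mod_cast (by omega : j + 1 < J + 1)
    · have h1 : ¬ s + 1 + a + p * j ≤ E.ν (k + 1) - 1 := fun h => hjJ ((hJ j).1 h)
      have := Nat.mul_le_mul_left p (show j ≤ J + l - 1 by omega)
      rw [E.interval_eq (k := k + 1) (by omega) (by omega)
        (show s + 1 + a + p * j < E.ν (k + 2) by omega), if_neg]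
      exact_mod_cast (by omega : ¬ j + 1 < J + 1)

/-- The rewards left to the bandit algorithm in an episode are those of a stationary instance, as long
as the episode stays within one interval. -/
theorem integral_loss_banditTable_le (B : BanditAlg A) {p k s L : ℕ} (hp : A < p) (hk : k ≤ E.N)
    (hs : E.ν k ≤ s + 1) (hL : s + L < E.ν (k + 1)) :
    ∫ x, B.loss (gap (E.law (k + 1))) (Nat.count (fun v => A ≤ v % p) L) (banditTable p s x)
      ∂E.rewardLaw ≤ B.regret (E.law (k + 1)) L := by
  set n := Nat.count (fun v => A ≤ v % p) L with hn
  set g := gap (E.law (k + 1))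
  have hinf : (Set.ofPred fun v => A ≤ v % p).Infinite := by
    refine Set.infinite_of_injective_forall_mem (f := fun j => A + p * j) (fun i j hij =>
      Nat.eq_of_mul_eq_mul_left (by omega : 0 < p) (Nat.add_left_cancel hij)) fun j => ?_
    simp [Nat.mod_eq_of_lt hp]
  have hinj : Function.Injective fun i => s + 1 + Nat.nth (fun v => A ≤ v % p) i := fun i j hij =>
    Nat.nth_injective hinf (Nat.add_left_cancel hij)
  have hmt : Measurable (banditTable (A := A) p s) := by
    unfold banditTable
    fun_prop
  have hmap : E.rewardLaw.map (banditTable p s) = Measure.infinitePi fun i => Measure.pi fun a =>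
      (E.law (E.interval (s + 1 + Nat.nth (fun v => A ≤ v % p) i)) a : Measure ℝ) := by
    refine (map_infinitePi_subsequence
      (fun t : ℕ => Measure.pi fun b => (E.law (E.interval t) b : Measure ℝ)) hinj
      measurable_id).trans ?_
    simp
  have h1 : ∫ x, B.loss g n (banditTable p s x) ∂E.rewardLaw = B.regret (E.law (k + 1)) n := by
    rw [← integral_map (φ := banditTable p s) (f := B.loss g n) hmt.aemeasurable
      (B.measurable_loss g n).aestronglyMeasurable, hmap]
    have hc := map_infinitePi_congr
      (μ := fun i => Measure.pi fun a =>
        (E.law (E.interval (s + 1 + Nat.nth (fun v => A ≤ v % p) i)) a : Measure ℝ))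
      (μ' := fun _ => Measure.pi fun a => (E.law (k + 1) a : Measure ℝ))
      (B.measurable_loss g n) (B.dependsOn_loss g n) fun i hi => by
        have := Nat.nth_lt_of_lt_count (hn ▸ Finset.mem_range.1 hi)
        rw [E.interval_eq hk (by omega) (by omega)]
    have := congrArg (fun m => ∫ y, y ∂m) hc
    rw [integral_map (B.measurable_loss g n).aemeasurable (by fun_prop),
      integral_map (B.measurable_loss g n).aemeasurable (by fun_prop)] at this
    exact this
  exact h1.le.trans (B.regret_mono _ (Nat.count_le _))

end PSBandit

/-! ### Regret in a detectable environment -/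

namespace PSBandit

/-- Summation over the possible times `s` of a restart: if, for each of them, `h s` is a function of the
rewards after `s` with expectation at most `β`, then the expectation of `h` at the actual time of the
restart is at most `β`, by independence and disjointness of the events. -/
theorem sum_integral_restartSet_le (E : PSBandit A T) (D : ChangeDetector) (p : ℕ → ℕ) (k : ℕ)
    (W : Finset ℕ) {h : ℕ → (ℕ → Fin A → ℝ) → ℝ} {β : ℝ} (hβ : 0 ≤ β)
    (hm : ∀ s ∈ W, Measurable (h s))
    (hd : ∀ s ∈ W, ∃ t : Finset ℕ, Disjoint (Finset.Iic s) t ∧ DependsOn (h s) (t : Set ℕ))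
    (hint : ∀ s ∈ W, ∫ x, h s x ∂E.rewardLaw ≤ β) :
    ∑ s ∈ W, ∫ x, (restartSet D p k s).indicator (h s) x ∂E.rewardLaw ≤ β := by
  have hstep : ∀ s ∈ W, ∫ x, (restartSet D p k s).indicator (h s) x ∂E.rewardLaw ≤
      E.rewardLaw.real (restartSet D p k s) * β := by
    intro s hs
    obtain ⟨t, hst, ht⟩ := hd s hs
    have := integral_indicator_mul_of_dependsOn
      (fun t : ℕ => Measure.pi fun b => (E.law (E.interval t) b : Measure ℝ)) hst
      (measurableSet_restartSet D p k s) (hm s hs) (dependsOn_mem_restartSet D p k s) ht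
    refine this.le.trans ?_
    exact mul_le_mul_of_nonneg_left (hint s hs) measureReal_nonneg
  refine (Finset.sum_le_sum hstep).trans ?_
  rw [← Finset.sum_mul]
  refine mul_le_of_le_one_left hβ ?_
  rw [← measureReal_biUnion_finset]
  · exact measureReal_le_one
  · intro s _ t _ hst
    exact Set.disjoint_left.2 fun x hx hx' => hst (eq_of_mem_restartSet hx hx')
  · exact fun s _ => measurableSet_restartSet D p k s

/-- The times at which the restart that follows the `k`-th change-point is due, when the latency of
the procedure at this change-point is `w`. An episode that starts after time `s` has its first round at
`s + 1`, so `s = ν k - 1` is allowed; for `k = 0` and `w = 0` it is the only possibility. -/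
def restartWindow (E : PSBandit A T) (w k : ℕ) : Finset ℕ :=
  Finset.Ico (E.ν k - 1) (E.ν k + w)

theorem mem_restartWindow {E : PSBandit A T} {w k s : ℕ} (h : s ∈ E.restartWindow w k) :
    E.ν k ≤ s + 1 ∧ s + 1 ≤ E.ν k + w := by
  rw [restartWindow, Finset.mem_Ico] at h
  omega

/-- The reward tables on which the `k`-th restart occurs within its window. -/
def timelySet (E : PSBandit A T) (D : ChangeDetector) (p : ℕ → ℕ) (w k : ℕ) :
    Set (ℕ → Fin A → ℝ) :=
  ⋃ s ∈ E.restartWindow w k, restartSet D p k s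

theorem measurableSet_timelySet (E : PSBandit A T) (D : ChangeDetector) (p : ℕ → ℕ) (w k : ℕ) :
    MeasurableSet (E.timelySet D p w k) :=
  Finset.measurableSet_biUnion _ fun s _ => measurableSet_restartSet D p k s

/-- The changes of `E` are detected at level `δ` by the detector `D`, with pre-change window `m` and
latency `d`, when the exploration frequencies are `α`: an episode whose first round is at `ν k` or
later ends before `ν (k + 1)` with probability at most `A δ`, and outlasts the `p * d` rounds from
`ν (k + 1)` on with probability at most `δ`, if its period `p` leaves room for the window. -/
structure Detectable (E : PSBandit A T) (D : ChangeDetector) (α : ℕ → ℝ) (δ : ℝ) (m d : ℕ) :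
    Prop where
  three_le : 3 ≤ T
  arm_pos : 0 < A
  lt_period : ∀ k ≤ E.N, A < period A α (k + 1)
  separation : SeparationCondition E α m d
  level_nonneg : 0 ≤ δ
  not_isQuiet_le : ∀ k ≤ E.N, ∀ s t p : ℕ, 0 < p → E.ν k ≤ s + 1 → t < E.ν (k + 1) →
    E.rewardLaw.real {x | ¬ IsQuiet D p s t x} ≤ A * δ
  isQuiet_le : ∀ k, k + 1 ≤ E.N → ∀ s p : ℕ, A ≤ p → 1 < p → E.ν k ≤ s + 1 →
    s + p * m < E.ν (k + 1) → E.ν (k + 1) + p * d ≤ E.ν (k + 2) →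
    E.rewardLaw.real {x | IsQuiet D p s (E.ν (k + 1) + p * d - 1) x} ≤ δ

variable {E : PSBandit A T} {D : ChangeDetector} {α : ℕ → ℝ} {δ : ℝ} {m d : ℕ}

theorem Detectable.one_lt_period (h : E.Detectable D α δ m d) {k : ℕ} (hk : k ≤ E.N) :
    1 < period A α (k + 1) := by
  have := h.lt_period k hk
  have := h.arm_pos
  omega

/-- A restart that is due in the window after the `k`-th change-point fails to occur there with
probability at most `k (A + 1) δ`: a timely restart is followed by another one unless some detector
raises a false alarm or the next change is missed. -/
theorem Detectable.compl_timelySet_le (h : E.Detectable D α δ m d) {k : ℕ} (hk : k ≤ E.N)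
    (hw : ∀ j, 1 ≤ j → j ≤ k → E.ν j + latencyAt A α d j ≤ E.ν (j + 1)) :
    E.rewardLaw.real (E.timelySet D (period A α) (latencyAt A α d k) k)ᶜ ≤ k * ((A + 1) * δ) := by
  induction k with
  | zero =>
    have : (E.timelySet D (period A α) (latencyAt A α d 0) 0)ᶜ = ∅ := by
      rw [Set.compl_empty_iff, Set.eq_univ_iff_forall]
      intro x
      refine Set.mem_biUnion (x := 0) ?_ rfl
      simp [restartWindow, E.ν_zero, latencyAt]
    rw [this]
    simp
  | succ k ih =>
    have ih := ih (by omega) fun j h1 h2 => hw j h1 (by omega)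
    set p := period A α with hp
    set W := E.restartWindow (latencyAt A α d k) k with hW
    set b := E.ν (k + 1) - 1 with hb
    set c := E.ν (k + 1) + p (k + 1) * d - 1 with hc
    let bad : ℕ → Set (ℕ → Fin A → ℝ) := fun s =>
      {x | ¬ IsQuiet D (p (k + 1)) s b x} ∪ {x | IsQuiet D (p (k + 1)) s c x}
    have hbm : ∀ s, MeasurableSet (bad s) := fun s =>
      (measurableSet_isQuiet D _ s b).compl.union (measurableSet_isQuiet D _ s c)
    have hν := E.one_le_ν (show k + 1 ≤ E.N + 1 by omega)
    have hsep : latencyAt A α d k + p (k + 1) * m ≤ E.ν (k + 1) - E.ν k := by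
      simpa [windowAt] using h.separation (k + 1) (Finset.mem_Icc.2 ⟨by omega, hk⟩)
    have hwk : latencyAt A α d (k + 1) = p (k + 1) * d := if_neg (by omega)
    have hνlt := E.ν_lt k (by omega)
    have hsub : (E.timelySet D p (latencyAt A α d (k + 1)) (k + 1))ᶜ ⊆
        (E.timelySet D p (latencyAt A α d k) k)ᶜ ∪ ⋃ s ∈ W, restartSet D p k s ∩ bad s := by
      intro x hx
      by_cases hxk : x ∈ E.timelySet D p (latencyAt A α d k) k
      swap
      · exact Or.inl hxk
      right
      simp only [timelySet, Set.mem_iUnion, exists_prop] at hxk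
      obtain ⟨s, hs, hxs⟩ := hxk
      refine Set.mem_biUnion hs ⟨hxs, ?_⟩
      by_contra hbad
      simp only [bad, Set.mem_union, Set.mem_ofPred_eq, not_or, not_not] at hbad
      obtain ⟨t, hbt, htc, hxt⟩ := exists_mem_restartSet_succ hxs hbad.1 hbad.2
      refine hx (Set.mem_biUnion (x := t) ?_ hxt)
      rw [hwk, restartWindow, Finset.coe_Ico, Set.mem_Ico]
      omega
    have hbad : ∀ s ∈ W, E.rewardLaw.real (bad s) ≤ (A + 1) * δ := by
      intro s hs
      obtain ⟨hs1, hs2⟩ := mem_restartWindow hs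
      refine (measureReal_union_le _ _).trans ?_
      have h1 := h.not_isQuiet_le k (by omega) s b (p (k + 1))
        (Nat.zero_lt_of_lt (h.one_lt_period (k := k) (by omega))) hs1 (by omega)
      have h2 := h.isQuiet_le k hk s (p (k + 1)) (h.lt_period k (by omega)).le
        (h.one_lt_period (by omega)) hs1 (by omega)
        (hwk ▸ hw (k + 1) (by omega) le_rfl)
      linarith
    have hβ : 0 ≤ (A + 1) * δ := mul_nonneg (by positivity) h.level_nonneg
    have hsum := sum_integral_restartSet_le E D p k W (h := fun s => (bad s).indicator 1) hβ
      (fun s _ => measurable_one.indicator (hbm s)) (fun s _ => ⟨Finset.Ioc s (b ⊔ c), by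
          rw [Finset.disjoint_left]
          intro i hi hi'
          rw [Finset.mem_Iic] at hi
          rw [Finset.mem_Ioc] at hi'
          omega, fun x y hxy => by
          have h1 : IsQuiet D (p (k + 1)) s b x ↔ IsQuiet D (p (k + 1)) s b y :=
            isQuiet_congr fun i hi => hxy i (by
              rw [Finset.mem_Ioc] at hi
              rw [Finset.mem_coe, Finset.mem_Ioc]
              omega)
          have h2 : IsQuiet D (p (k + 1)) s c x ↔ IsQuiet D (p (k + 1)) s c y :=
            isQuiet_congr fun i hi => hxy i (by
              rw [Finset.mem_Ioc] at hi
              rw [Finset.mem_coe, Finset.mem_Ioc]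
              omega)
          have : x ∈ bad s ↔ y ∈ bad s := by
            simp only [bad, Set.mem_union, Set.mem_ofPred_eq, h1, h2]
          by_cases hx : x ∈ bad s
          · rw [Set.indicator_of_mem hx, Set.indicator_of_mem (this.1 hx)]; rfl
          · rw [Set.indicator_of_notMem hx, Set.indicator_of_notMem (mt this.2 hx)]⟩)
      (fun s hs => by
        rw [integral_indicator_one (hbm s)]
        exact hbad s hs)
    refine (measureReal_mono hsub).trans ((measureReal_union_le _ _).trans ?_)
    have hunion := measureReal_biUnion_finset_le (μ := E.rewardLaw) W
      fun s => restartSet D p k s ∩ bad s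
    have heq : ∀ s ∈ W, E.rewardLaw.real (restartSet D p k s ∩ bad s) =
        ∫ x, (restartSet D p k s).indicator ((bad s).indicator 1) x ∂E.rewardLaw := fun s _ => by
      rw [Set.indicator_indicator, integral_indicator_one
        ((measurableSet_restartSet D p k s).inter (hbm s))]
    rw [Finset.sum_congr rfl heq] at hunion
    push_cast
    linarith

/-- Regret on the rounds `ν k, …, ν (k + 1) - 1`, for the rewards of the table `x`. -/
noncomputable def intervalRegret (E : PSBandit A T) (B : BanditAlg A) (D : ChangeDetector)
    (α : ℕ → ℝ) (k : ℕ) (x : ℕ → Fin A → ℝ) : ℝ :=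
  ∑ t ∈ Finset.Ico (E.ν k) (E.ν (k + 1)), gap (E.law (k + 1)) (action B D α x t)

theorem intervalRegret_le {C : ℝ} {k : ℕ} (hC : ∀ a, gap (E.law (k + 1)) a ≤ C)
    (B : BanditAlg A) (x : ℕ → Fin A → ℝ) :
    E.intervalRegret B D α k x ≤ C * (E.ν (k + 1) - E.ν k : ℕ) := by
  have := Finset.sum_le_card_nsmul (Finset.Ico (E.ν k) (E.ν (k + 1))) _ C fun t _ =>
    hC (action B D α x t)
  rw [Nat.card_Ico, nsmul_eq_mul, mul_comm] at this
  exact this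

/-- Regret on an interval without false alarm and after a timely restart: delay, forced exploration and
regret of the bandit algorithm. -/
theorem Detectable.intervalRegret_le_of_isQuiet (h : E.Detectable D α δ m d) {C : ℝ} (hC0 : 0 ≤ C)
    {k s w : ℕ} (hk : k ≤ E.N) (hC : ∀ a, gap (E.law (k + 1)) a ≤ C) (B : BanditAlg A)
    (hs : s ∈ E.restartWindow w k) (hw : E.ν k + w ≤ E.ν (k + 1)) {x : ℕ → Fin A → ℝ}
    (hx : x ∈ restartSet D (period A α) k s)
    (hq : IsQuiet D (period A α (k + 1)) s (E.ν (k + 1) - 1) x) :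
    E.intervalRegret B D α k x ≤ C * w +
      (C * (A * ((E.ν (k + 1) - E.ν k : ℕ) / period A α (k + 1) + 1)) +
        B.loss (gap (E.law (k + 1)))
          (Nat.count (fun v => A ≤ v % period A α (k + 1)) (E.ν (k + 1) - 1 - s))
          (banditTable (period A α (k + 1)) s x)) := by
  obtain ⟨hs1, hs2⟩ := mem_restartWindow hs
  have hp := h.one_lt_period hk
  rw [intervalRegret, ← Finset.sum_Ico_consecutive _ hs1 (show s + 1 ≤ E.ν (k + 1) by omega)]
  refine add_le_add ?_ ?_
  · have := Finset.sum_le_card_nsmul (Finset.Ico (E.ν k) (s + 1)) _ C fun t _ =>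
      hC (action B D α x t)
    rw [Nat.card_Ico, nsmul_eq_mul, mul_comm] at this
    refine this.trans (mul_le_mul_of_nonneg_left ?_ hC0)
    exact_mod_cast (by omega : s + 1 - E.ν k ≤ w)
  · rw [Finset.sum_Ico_eq_sum_range]
    have hst := state_of_mem_restartSet B D α (fun j hj => (h.lt_period j (by omega)).le) hx
    have hL : E.ν (k + 1) - (s + 1) = E.ν (k + 1) - 1 - s := by omega
    have := sum_range_episode_le (gap (E.law (k + 1))) hC B D α hst
      (L := E.ν (k + 1) - 1 - s) (by omega) hC0
      (by rwa [show s + (E.ν (k + 1) - 1 - s) = E.ν (k + 1) - 1 by omega])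
    rw [hL]
    simp only [show ∀ u, s + 1 + u = s + u + 1 by intro u; omega]
    refine this.trans (add_le_add ?_ le_rfl)
    have hle : ((E.ν (k + 1) - 1 - s : ℕ) : ℝ) ≤ (E.ν (k + 1) - E.ν k : ℕ) := by
      exact_mod_cast (by omega : E.ν (k + 1) - 1 - s ≤ E.ν (k + 1) - E.ν k)
    gcongr

/-- Expected regret on the interval that starts at `ν k`. The bound is passed through an integrable
majorant `g`, so that the measurability of the arms that the procedure plays is not needed. -/
theorem Detectable.exists_intervalRegret_bound (h : E.Detectable D α δ m d) {C : ℝ} (hC0 : 0 ≤ C)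
    {k : ℕ} (hk : k ≤ E.N) (hC : ∀ a, gap (E.law (k + 1)) a ≤ C) (B : BanditAlg A)
    (hw : ∀ j, 1 ≤ j → j ≤ k → E.ν j + latencyAt A α d j ≤ E.ν (j + 1)) :
    ∃ g : (ℕ → Fin A → ℝ) → ℝ, Integrable g E.rewardLaw ∧
      (∀ x, E.intervalRegret B D α k x ≤ g x) ∧
      ∫ x, g x ∂E.rewardLaw ≤ C * (E.ν (k + 1) - E.ν k : ℕ) * ((k + 1) * ((A + 1) * δ)) +
        C * latencyAt A α d k +
        C * (A * ((E.ν (k + 1) - E.ν k : ℕ) / period A α (k + 1) + 1)) +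
        B.regret (E.law (k + 1)) (E.ν (k + 1) - E.ν k) := by
  set p := period A α with hp
  set w := latencyAt A α d k with hwd
  set n := E.ν (k + 1) - E.ν k with hn
  set W := E.restartWindow w k with hW
  have hν := E.ν_lt k hk
  have hν1 := E.one_le_ν (show k ≤ E.N + 1 by omega)
  have hwk : E.ν k + w ≤ E.ν (k + 1) := by
    rcases Nat.eq_zero_or_pos k with h0 | h0
    · have : w = 0 := by rw [hwd, latencyAt, if_pos h0]
      omega
    · exact hw k h0 le_rfl
  have hppos := h.one_lt_period hk
  let q : ℕ → Set (ℕ → Fin A → ℝ) := fun s => {x | ¬ IsQuiet D (p (k + 1)) s (E.ν (k + 1) - 1) x}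
  have hqm : ∀ s, MeasurableSet (q s) := fun s => (measurableSet_isQuiet D _ s _).compl
  let cnt : ℕ → ℕ := fun s => Nat.count (fun v => A ≤ v % p (k + 1)) (E.ν (k + 1) - 1 - s)
  let los : ℕ → (ℕ → Fin A → ℝ) → ℝ := fun s x =>
    B.loss (gap (E.law (k + 1))) (cnt s) (banditTable (p (k + 1)) s x)
  have hmt : ∀ s, Measurable (banditTable (A := A) (p (k + 1)) s) := fun s => by
    unfold banditTable
    fun_prop
  let c₀ : ℝ := C * w + C * (A * (n / p (k + 1) + 1))
  have hc₀ : 0 ≤ c₀ := by positivity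
  let hh : ℕ → (ℕ → Fin A → ℝ) → ℝ := fun s x => c₀ + (q s).indicator (fun _ => C * n) x + los s x
  have hlosm : ∀ s, Measurable (los s) := fun s => (B.measurable_loss _ _).comp (hmt s)
  have hhm : ∀ s, Measurable (hh s) := fun s =>
    (measurable_const.add (measurable_const.indicator (hqm s))).add (hlosm s)
  have hqi : ∀ s, Integrable ((q s).indicator fun _ => C * n) E.rewardLaw := fun s =>
    (integrable_const _).indicator (hqm s)
  have hli : ∀ s, Integrable (los s) E.rewardLaw := fun s => B.integrable_loss _ _ _ (hmt s)
  have hhi : ∀ s, Integrable (hh s) E.rewardLaw := fun s =>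
    ((integrable_const _).add (hqi s)).add (hli s)
  have hCn : 0 ≤ C * n := by positivity
  have hhint : ∀ s ∈ W, ∫ x, hh s x ∂E.rewardLaw ≤
      c₀ + A * δ * (C * n) + B.regret (E.law (k + 1)) n := by
    intro s hs
    obtain ⟨hs1, hs2⟩ := mem_restartWindow hs
    have e1 : ∫ x, hh s x ∂E.rewardLaw =
        c₀ + E.rewardLaw.real (q s) * (C * n) + ∫ x, los s x ∂E.rewardLaw := by
      simp only [hh]
      have hci : Integrable (fun _ => c₀) E.rewardLaw := integrable_const _
      have hcqi : Integrable (fun x => c₀ + (q s).indicator (fun _ => C * (n : ℝ)) x)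
        E.rewardLaw := hci.add (hqi s)
      rw [integral_add hcqi (hli s), integral_add hci (hqi s), integral_indicator_const _ (hqm s)]
      simp
    rw [e1]
    refine add_le_add (add_le_add le_rfl (mul_le_mul_of_nonneg_right ?_ hCn)) ?_
    · exact h.not_isQuiet_le k hk s _ _ (Nat.zero_lt_of_lt hppos) hs1 (by omega)
    · exact (E.integral_loss_banditTable_le B (h.lt_period k hk) hk hs1 (by omega)).trans
        (B.regret_mono _ (by omega))
  have hreg0 : 0 ≤ B.regret (E.law (k + 1)) n :=
    integral_nonneg fun x => B.loss_nonneg (gap_nonneg _) n x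
  have hsum := sum_integral_restartSet_le E D p k W (h := hh)
    (β := c₀ + A * δ * (C * n) + B.regret (E.law (k + 1)) n)
    (by have := h.level_nonneg; positivity) (fun s _ => hhm s) (fun s hs => by
      refine ⟨Finset.Ioc s (E.ν (k + 1) - 1) ∪
        (Finset.range (cnt s)).image (fun i => s + 1 + Nat.nth (fun v => A ≤ v % p (k + 1)) i),
        ?_, fun x y hxy => ?_⟩
      · rw [Finset.disjoint_left]
        intro i hi hi'
        simp only [Finset.mem_Iic, Finset.mem_union, Finset.mem_Ioc, Finset.mem_image] at hi hi'
        rcases hi' with h1 | ⟨j, _, h1⟩ <;> omega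
      · have h1 : x ∈ q s ↔ y ∈ q s := not_congr (isQuiet_congr fun i hi => hxy i (by
          rw [Finset.mem_coe, Finset.mem_union]; exact Or.inl hi))
        have h2 : los s x = los s y := B.dependsOn_loss _ _ fun i hi => hxy _ (by
          rw [Finset.mem_coe, Finset.mem_union]
          exact Or.inr (Finset.mem_image_of_mem _ (Finset.mem_coe.1 hi)))
        have h3 : (q s).indicator (fun _ => C * (n : ℝ)) x =
            (q s).indicator (fun _ => C * (n : ℝ)) y := by
          by_cases hx : x ∈ q s
          · rw [Set.indicator_of_mem hx, Set.indicator_of_mem (h1.1 hx)]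
          · rw [Set.indicator_of_notMem hx, Set.indicator_of_notMem (mt h1.2 hx)]
        simp only [hh, h2, h3]) hhint
  set G := E.timelySet D p w k with hG
  have hGm : MeasurableSet G := E.measurableSet_timelySet D p w k
  have hFi : ∀ s ∈ W, Integrable ((restartSet D p k s).indicator (hh s)) E.rewardLaw := fun s _ =>
    (hhi s).indicator (measurableSet_restartSet D p k s)
  have hGi : Integrable (Gᶜ.indicator fun _ => C * n) E.rewardLaw :=
    (integrable_const _).indicator hGm.compl
  refine ⟨fun x => Gᶜ.indicator (fun _ => C * n) x +
    ∑ s ∈ W, (restartSet D p k s).indicator (hh s) x, hGi.add (integrable_finsetSum _ hFi),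
    fun x => ?_, ?_⟩
  · have hlos0 : ∀ s, 0 ≤ los s x := fun s => B.loss_nonneg (gap_nonneg _) _ _
    have hind0 : ∀ s, 0 ≤ (q s).indicator (fun _ => C * n) x := fun s =>
      Set.indicator_nonneg (fun _ _ => hCn) x
    have hh0 : ∀ s, 0 ≤ hh s x := fun s => add_nonneg (add_nonneg hc₀ (hind0 s)) (hlos0 s)
    by_cases hx : x ∈ G
    · simp only [hG, timelySet, Set.mem_iUnion, exists_prop] at hx
      obtain ⟨s, hs, hxs⟩ := hx
      have h1 : hh s x ≤ ∑ s ∈ W, (restartSet D p k s).indicator (hh s) x := by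
        refine le_trans (le_of_eq ?_) (Finset.single_le_sum
          (f := fun s => (restartSet D p k s).indicator (hh s) x)
          (fun s _ => Set.indicator_apply_nonneg fun _ => hh0 s) hs)
        simp only [Set.indicator_of_mem hxs]
      have h2 : 0 ≤ Gᶜ.indicator (fun _ => C * (n : ℝ)) x :=
        Set.indicator_nonneg (fun _ _ => hCn) x
      refine le_trans ?_ (h1.trans (le_add_of_nonneg_left h2))
      by_cases hq : IsQuiet D (p (k + 1)) s (E.ν (k + 1) - 1) x
      · have := h.intervalRegret_le_of_isQuiet hC0 hk hC B hs hwk hxs hq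
        have h3 := hind0 s
        simp only [hh, c₀]
        linarith
      · have h3 : (q s).indicator (fun _ => C * (n : ℝ)) x = C * n := Set.indicator_of_mem hq _
        have := E.intervalRegret_le (D := D) (α := α) hC B x
        have h4 := hlos0 s
        simp only [hh, h3]
        linarith
    · have h1 : Gᶜ.indicator (fun _ => C * (n : ℝ)) x = C * n := Set.indicator_of_mem hx _
      simp only [h1]
      refine (E.intervalRegret_le hC B x).trans (le_add_of_nonneg_right ?_)
      exact Finset.sum_nonneg fun s _ => Set.indicator_apply_nonneg fun _ => hh0 s
  · rw [integral_add hGi (integrable_finsetSum _ hFi), integral_finsetSum _ hFi,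
      integral_indicator_const _ hGm.compl, smul_eq_mul]
    have h1 := mul_le_mul_of_nonneg_right (h.compl_timelySet_le hk hw) hCn
    have h2 : 0 ≤ δ * (C * n) := mul_nonneg h.level_nonneg hCn
    simp only [c₀] at hsum
    linarith

/-- Regret of the procedure in a detectable environment, with the four contributions of false alarms
and missed detections, delay, forced exploration, and the bandit algorithm. -/
theorem Detectable.regret_le (h : E.Detectable D α δ m d) {C : ℝ} (hC0 : 0 ≤ C)
    (hC : ∀ k ≤ E.N, ∀ a, gap (E.law (k + 1)) a ≤ C) (B : BanditAlg A) :
    regret E B D α ≤ ∑ k ∈ Finset.range (E.N + 1),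
      (C * (E.ν (k + 1) - E.ν k : ℕ) * ((k + 1) * ((A + 1) * δ)) + C * latencyAt A α d k +
        C * (A * ((E.ν (k + 1) - E.ν k : ℕ) / period A α (k + 1) + 1)) +
        B.regret (E.law (k + 1)) (E.ν (k + 1) - E.ν k)) := by
  have hw : ∀ j, 1 ≤ j → j < E.N → E.ν j + latencyAt A α d j ≤ E.ν (j + 1) := by
    intro j hj hjN
    have := h.separation (j + 1) (Finset.mem_Icc.2 ⟨by omega, by omega⟩)
    have h2 := E.ν_lt j (by omega)
    simp only [Nat.add_sub_cancel] at this
    omega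
  have hk : ∀ k ≤ E.N, ∃ g : (ℕ → Fin A → ℝ) → ℝ, Integrable g E.rewardLaw ∧
      (∀ x, E.intervalRegret B D α k x ≤ g x) ∧
      ∫ x, g x ∂E.rewardLaw ≤ C * (E.ν (k + 1) - E.ν k : ℕ) * ((k + 1) * ((A + 1) * δ)) +
        C * latencyAt A α d k +
        C * (A * ((E.ν (k + 1) - E.ν k : ℕ) / period A α (k + 1) + 1)) +
        B.regret (E.law (k + 1)) (E.ν (k + 1) - E.ν k) := by
    intro k hk
    -- if the last interval is shorter than the latency, its whole regret counts as delay
    by_cases hlast : k = E.N ∧ 1 ≤ k ∧ E.ν (k + 1) < E.ν k + latencyAt A α d k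
    · refine ⟨fun _ => C * (E.ν (k + 1) - E.ν k : ℕ), integrable_const _,
        E.intervalRegret_le (hC k hk) B, ?_⟩
      have h1 : ((E.ν (k + 1) - E.ν k : ℕ) : ℝ) ≤ latencyAt A α d k := by
        exact_mod_cast (by omega : E.ν (k + 1) - E.ν k ≤ latencyAt A α d k)
      have h2 := mul_le_mul_of_nonneg_left h1 hC0
      have h3 : 0 ≤ B.regret (E.law (k + 1)) (E.ν (k + 1) - E.ν k) :=
        integral_nonneg fun x => B.loss_nonneg (gap_nonneg _) _ x
      have h4 : 0 ≤ C * (E.ν (k + 1) - E.ν k : ℕ) * ((k + 1) * ((A + 1) * δ)) := by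
        have := h.level_nonneg
        positivity
      have h5 : 0 ≤ C * (A * (((E.ν (k + 1) - E.ν k : ℕ) : ℝ) / period A α (k + 1) + 1)) := by
        positivity
      simp only [integral_const, probReal_univ, one_smul]
      linarith
    · refine h.exists_intervalRegret_bound hC0 hk (hC k hk) B fun j hj hjk => ?_
      rcases (hjk.trans hk).lt_or_eq with hjN | rfl
      · exact hw j hj hjN
      · obtain rfl : k = E.N := le_antisymm hk hjk
        by_contra hcon
        exact hlast ⟨rfl, hj, not_le.1 hcon⟩
  choose! g hgi hgle hgint using hk
  have hreg : regret E B D α =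
      ∫ x, ∑ k ∈ Finset.range (E.N + 1), E.intervalRegret B D α k x ∂E.rewardLaw := by
    rw [regret]
    congr 1
    funext x
    rw [Finset.range_eq_Ico]
    trans ∑ k ∈ Finset.Ico (0 + 1) (E.N + 1 + 1), ∑ t ∈ Finset.Ico (E.ν (k - 1)) (E.ν k),
      gap (E.law k) (action B D α x t)
    · rfl
    rw [← Finset.sum_Ico_add' (fun k => ∑ t ∈ Finset.Ico (E.ν (k - 1)) (E.ν k),
      gap (E.law k) (action B D α x t)) 0 (E.N + 1) 1]
    rfl
  have hmem : ∀ k ∈ Finset.range (E.N + 1), k ≤ E.N := fun k hk =>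
    Nat.lt_succ_iff.1 (Finset.mem_range.1 hk)
  rw [hreg]
  calc _ ≤ ∫ x, ∑ k ∈ Finset.range (E.N + 1), g k x ∂E.rewardLaw := by
        refine integral_mono_of_nonneg (ae_of_all _ fun x => ?_)
          (integrable_finsetSum _ fun k hk => hgi k (hmem k hk)) (ae_of_all _ fun x => ?_)
        · exact Finset.sum_nonneg fun k _ => Finset.sum_nonneg fun t _ => gap_nonneg _ _
        · exact Finset.sum_le_sum fun k hk => hgle k (hmem k hk) x
    _ = ∑ k ∈ Finset.range (E.N + 1), ∫ x, g k x ∂E.rewardLaw :=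
        integral_finsetSum _ fun k hk => hgi k (hmem k hk)
    _ ≤ _ := Finset.sum_le_sum fun k hk => hgint k (hmem k hk)

end PSBandit

/-! ### Admissible environments -/

namespace PSBandit

variable {E : PSBandit A T}

theorem exists_abs_eq_changeGap (hA : 0 < A) (E : PSBandit A T) (k : ℕ) :
    ∃ a, |mean (E.law k a) - mean (E.law (k + 1) a)| = E.changeGap k := by
  have : Nonempty (Fin A) := ⟨⟨0, hA⟩⟩
  obtain ⟨a, ha⟩ := exists_eq_ciSup_of_finite
    (f := fun a => |mean (E.law (k + 1) a) - mean (E.law k a)|)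
  exact ⟨a, by rw [abs_sub_comm]; exact ha⟩

/-- At each change-point some arm shifts by at least `Δ`, and the window and the latency that the
detector needs for this shift are at most those for `Δ`. -/
theorem Admissible.detectable {σ : ℝ≥0} {C Δ δ : ℝ} (h : E.Admissible σ C Δ) (hΔ : 0 < Δ)
    {D : ℕ → ℝ → ℝ → ChangeDetector} {m d : ℝ → ℕ → ℝ → ℝ → ℕ} (hD : IsGoodDetector σ D m d)
    {α : ℕ → ℝ} (hδ : δ ∈ Set.Ioo (0 : ℝ) 1) (hT : 3 ≤ T) (hA : 0 < A)
    (hp : ∀ k ≤ E.N, A < period A α (k + 1))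
    (hsep : SeparationCondition E α (m Δ T δ δ) (d Δ T δ δ)) :
    E.Detectable (D T δ δ) α δ (m Δ T δ δ) (d Δ T δ δ) where
  three_le := hT
  arm_pos := hA
  lt_period := hp
  separation := hsep
  level_nonneg := hδ.1.le
  not_isQuiet_le k hk s t p hp0 hs ht :=
    E.not_isQuiet_le hp0 (hD.false_alarm T δ δ hδ hδ) hk
      (h.subGaussian (k + 1) (Finset.mem_Icc.2 ⟨by omega, by omega⟩)) hs ht
  isQuiet_le k hk s p hAp hp1 hs hs' hd := by
    obtain ⟨a, ha⟩ := E.exists_abs_eq_changeGap hA (k + 1)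
    set Δ' := E.changeGap (k + 1) with hΔ'
    have hle : Δ ≤ Δ' := h.le_changeGap (k + 1) (Finset.mem_Icc.2 ⟨by omega, hk⟩)
    have hpos : 0 < Δ' := hΔ.trans_le hle
    -- `T` itself is an admissible latency, for want of change-points to test it
    have hmem := Nat.sInf_mem (s := {t : ℕ | 1 ≤ t ∧ t ≤ T ∧
      ∀ f₀ f₁ : ProbabilityMeasure ℝ, IsSubGaussian σ f₀ → IsSubGaussian σ f₁ →
        |mean f₀ - mean f₁| = Δ' → ∀ ν : ℕ, m Δ' T δ δ + 1 ≤ ν → ν ≤ T - t →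
          (changeLaw f₀ f₁ ν).real {x | ((ν + t : ℕ) : ℕ∞) ≤ (D T δ δ).stoppingTime x} ≤ δ})
      ⟨T, by omega, le_rfl, fun _ _ _ _ _ ν h1 h2 => by omega⟩
    have hlat := hD.latency_le Δ' T δ δ hpos hδ hδ
    rw [ChangeDetector.latency] at hlat
    have hmono := hD.antitone_shift T δ δ hδ hδ
    have hm : m Δ' T δ δ ≤ m Δ T δ δ := hmono.1 hΔ hpos hle
    have hdd : d Δ' T δ δ ≤ d Δ T δ δ := hmono.2 hΔ hpos hle
    exact E.isQuiet_le (a := a) hAp hp1 hT hmem.1 (hlat.trans hdd)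
      (fun ν h1 h2 => hmem.2.2 _ _
        (h.subGaussian (k + 1) (Finset.mem_Icc.2 ⟨by omega, by omega⟩) a)
        (h.subGaussian (k + 2) (Finset.mem_Icc.2 ⟨by omega, by omega⟩) a) ha ν (by omega) h2)
      hk hs hs' hd

theorem minSeparation_le (E : PSBandit A T) {k : ℕ} (hk : 1 ≤ k) (hkN : k ≤ E.N) :
    E.minSeparation ≤ E.ν k - E.ν (k - 1) :=
  Nat.sInf_le ⟨k, ⟨hk, hkN⟩, rfl⟩

theorem mul_minSeparation_le (E : PSBandit A T) : E.N * E.minSeparation ≤ T := by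
  have h : ∀ j ≤ E.N, j * E.minSeparation + 1 ≤ E.ν j := by
    intro j
    induction j with
    | zero => simp [E.ν_zero]
    | succ j ih =>
      intro hj
      have h1 := ih (by omega)
      have h2 := E.minSeparation_le (k := j + 1) (by omega) hj
      have h3 := E.ν_lt j (by omega)
      rw [add_mul, one_mul]
      simp only [Nat.add_sub_cancel] at h2
      omega
  have h1 := h E.N le_rfl
  have h2 := E.ν_le (show E.N ≤ E.N + 1 by omega)
  omega

theorem sum_length (E : PSBandit A T) :
    ∑ k ∈ Finset.range (E.N + 1), ((E.ν (k + 1) - E.ν k : ℕ) : ℝ) = T := by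
  have h : ∀ k ∈ Finset.range (E.N + 1), ((E.ν (k + 1) - E.ν k : ℕ) : ℝ) =
      (E.ν (k + 1) : ℝ) - E.ν k := fun k hk =>
    Nat.cast_sub (E.ν_lt k (Nat.lt_succ_iff.1 (Finset.mem_range.1 hk))).le
  rw [Finset.sum_congr rfl h, Finset.sum_range_sub (fun k => (E.ν k : ℝ)), E.ν_last, E.ν_zero]
  push_cast
  ring

end PSBandit

/-! ### Orders of magnitude -/

theorem freq_eq (α₀ : ℝ) (A T k : ℕ) :
    freq α₀ A T k = α₀ * (√k * √A * √(Real.log T) / √T) := by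
  rw [freq, Real.sqrt_div' _ (Nat.cast_nonneg T), Real.sqrt_mul (by positivity),
    Real.sqrt_mul (by positivity)]

theorem period_freq_le {α₀ : ℝ} (hα₀ : 0 < α₀) {A T k : ℕ} (hA : 0 < A) (hk : 0 < k)
    (hT : 1 < T) :
    (period A (freq α₀ A T) k : ℝ) ≤ √A * √T / (α₀ * √(Real.log T)) * (1 / √k) + 1 := by
  have hl : 0 < √(Real.log T) := Real.sqrt_pos.2 (Real.log_pos (by exact_mod_cast hT))
  have hA' : 0 < √(A : ℝ) := Real.sqrt_pos.2 (by exact_mod_cast hA)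
  have hT' : 0 < √(T : ℝ) := Real.sqrt_pos.2 (by exact_mod_cast (by omega : 0 < T))
  have hk' : 0 < √(k : ℝ) := Real.sqrt_pos.2 (by exact_mod_cast hk)
  have heq : (A : ℝ) / freq α₀ A T k = √A * √T / (α₀ * √(Real.log T)) * (1 / √k) := by
    rw [freq_eq]
    nth_rewrite 1 [← Real.mul_self_sqrt (Nat.cast_nonneg A)]
    field_simp
  rw [period, ← heq]
  exact (Nat.ceil_lt_add_one (by rw [heq]; positivity)).le

theorem sum_one_div_sqrt_le (N : ℕ) :
    ∑ k ∈ Finset.range N, 1 / √((k + 1 : ℕ) : ℝ) ≤ 2 * √N := by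
  induction N with
  | zero => simp
  | succ N ih =>
    rw [Finset.sum_range_succ]
    have h0 : 0 ≤ √(N : ℝ) := Real.sqrt_nonneg _
    have h1 : 0 < √((N + 1 : ℕ) : ℝ) := Real.sqrt_pos.2 (by positivity)
    have h2 : √((N + 1 : ℕ) : ℝ) ^ 2 = √(N : ℝ) ^ 2 + 1 := by
      rw [Real.sq_sqrt (by positivity), Real.sq_sqrt (by positivity)]
      push_cast
      ring
    have h3 : 1 / √((N + 1 : ℕ) : ℝ) ≤ 2 * (√((N + 1 : ℕ) : ℝ) - √(N : ℝ)) := by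
      rw [div_le_iff₀ h1]
      nlinarith [sq_nonneg (√((N + 1 : ℕ) : ℝ) - √(N : ℝ))]
    linarith

/-- The orders of magnitude at which the horizon `T` is large. The number of change-points is `N`;
the sum `w` of the pre-change window and the latency of the detector is at most `L * log T`; the bound
on the regret of the bandit algorithm is valid from `n₀` rounds on. -/
structure LargeHorizon (α₀ L : ℝ) (A T N n₀ w : ℕ) : Prop where
  arm_pos : 0 < A
  three_le : 3 ≤ T
  one_le : 1 ≤ N
  arm_le : (A : ℝ) ≤ Real.log T
  log_le : Real.log T ≤ T
  start_le : (2 * n₀ : ℝ) ^ 2 ≤ T * Real.log T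
  freq_lt : (2 * A * α₀ ^ 2) ^ 2 * Real.log T < T
  delay_le : (w : ℝ) ≤ L * Real.log T
  changes_le : (N : ℝ) * √(T * Real.log T) ≤ T

namespace LargeHorizon

variable {α₀ L : ℝ} {N n₀ w : ℕ}

theorem one_le_log (h : LargeHorizon α₀ L A T N n₀ w) : 1 ≤ Real.log T :=
  le_trans (by exact_mod_cast h.arm_pos) h.arm_le

theorem mul_sqrt_log_le (h : LargeHorizon α₀ L A T N n₀ w) :
    (N : ℝ) * √(Real.log T) ≤ √T := by
  have h1 := h.changes_le
  have hT : 0 < √(T : ℝ) := Real.sqrt_pos.2 (by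
    have := h.three_le
    exact_mod_cast (by omega : 0 < T))
  rw [Real.sqrt_mul (Nat.cast_nonneg T)] at h1
  have hT2 : √(T : ℝ) * √T = T := Real.mul_self_sqrt (Nat.cast_nonneg T)
  refine le_of_mul_le_mul_left ?_ hT
  linarith

theorem sqrt_succ_le (h : LargeHorizon α₀ L A T N n₀ w) : √((N + 1 : ℕ) : ℝ) ≤ 2 * √N := by
  have h1 : (1 : ℝ) ≤ N := by exact_mod_cast h.one_le
  rw [Real.sqrt_le_left (by positivity), mul_pow, Real.sq_sqrt (by positivity)]
  push_cast
  linarith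

theorem freq_lt_one (h : LargeHorizon α₀ L A T N n₀ w) (hα₀ : 0 < α₀) :
    freq α₀ A T (N + 1) < 1 := by
  have hN : (1 : ℝ) ≤ N := by exact_mod_cast h.one_le
  have hl := h.one_le_log
  have hT : (0 : ℝ) < T := by linarith [h.log_le]
  have hx : 2 * A * α₀ ^ 2 * √(Real.log T) < √T := by
    refine Real.lt_sqrt_of_sq_lt ?_
    rw [mul_pow, Real.sq_sqrt (by linarith)]
    exact h.freq_lt
  have hy := h.mul_sqrt_log_le
  rw [freq, ← lt_div_iff₀' hα₀, Real.sqrt_lt' (by positivity), div_lt_iff₀ hT, div_pow, one_pow,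
    div_mul_eq_mul_div, one_mul, lt_div_iff₀ (by positivity)]
  have hl2 : √(Real.log T) * √(Real.log T) = Real.log T := Real.mul_self_sqrt (by linarith)
  have hT2 : √(T : ℝ) * √T = T := Real.mul_self_sqrt hT.le
  have hTp : 0 < √(T : ℝ) := Real.sqrt_pos.2 hT
  calc ((N + 1 : ℕ) : ℝ) * A * Real.log T * α₀ ^ 2
      ≤ (2 * N) * A * Real.log T * α₀ ^ 2 := by
        push_cast
        gcongr
        linarith
    _ = (2 * A * α₀ ^ 2 * √(Real.log T)) * (N * √(Real.log T)) := by
        nth_rewrite 1 [← hl2]; ring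
    _ ≤ (2 * A * α₀ ^ 2 * √(Real.log T)) * √T := by gcongr
    _ < √T * √T := by gcongr
    _ = T := hT2

theorem freq_le (h : LargeHorizon α₀ L A T N n₀ w) (hα₀ : 0 < α₀) {k : ℕ} (hk : k ≤ N + 1) :
    freq α₀ A T k ≤ freq α₀ A T (N + 1) := by
  have := h.one_le_log
  unfold freq
  gcongr

theorem freq_pos (h : LargeHorizon α₀ L A T N n₀ w) (hα₀ : 0 < α₀) {k : ℕ} (hk : 0 < k) :
    0 < freq α₀ A T k := by
  have := h.one_le_log
  have := h.arm_pos
  have := h.three_le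
  have h3 : (0 : ℝ) < T := by exact_mod_cast (by omega : 0 < T)
  unfold freq
  positivity

theorem lt_period (h : LargeHorizon α₀ L A T N n₀ w) (hα₀ : 0 < α₀) {k : ℕ} (hk : k ≤ N) :
    A < period A (freq α₀ A T) (k + 1) := by
  have h1 := h.freq_pos hα₀ (Nat.succ_pos k)
  have h2 := (h.freq_le hα₀ (show k + 1 ≤ N + 1 by omega)).trans_lt (h.freq_lt_one hα₀)
  rw [period, Nat.lt_ceil, lt_div_iff₀ h1]
  have hA : (0 : ℝ) < A := by exact_mod_cast h.arm_pos
  nlinarith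

theorem div_period_le (h : LargeHorizon α₀ L A T N n₀ w) (hα₀ : 0 < α₀) {k : ℕ} (hk : k ≤ N) :
    (A : ℝ) / period A (freq α₀ A T) (k + 1) ≤ freq α₀ A T (N + 1) := by
  refine le_trans ?_ (h.freq_le hα₀ (show k + 1 ≤ N + 1 by omega))
  have h1 := h.freq_pos hα₀ (Nat.succ_pos k)
  have h2 := h.lt_period hα₀ hk
  have h3 : (0 : ℝ) < period A (freq α₀ A T) (k + 1) := by
    exact_mod_cast (by omega : 0 < period A (freq α₀ A T) (k + 1))
  rw [div_le_iff₀ h3, ← div_le_iff₀' h1]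
  exact Nat.le_ceil _

theorem period_le (h : LargeHorizon α₀ L A T N n₀ w) (hα₀ : 0 < α₀) {k : ℕ} (hk : 0 < k) :
    (period A (freq α₀ A T) k : ℝ) ≤ √A * √T / (α₀ * √(Real.log T)) + 1 := by
  refine (period_freq_le hα₀ h.arm_pos hk (by have := h.three_le; omega)).trans ?_
  have h1 : 1 / √(k : ℝ) ≤ 1 := by
    have : (1 : ℝ) ≤ √(k : ℝ) := Real.one_le_sqrt.2 (by exact_mod_cast hk)
    exact div_le_one_of_le₀ this (by positivity)
  have : √(A : ℝ) * √T / (α₀ * √(Real.log T)) * (1 / √k) ≤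
    √(A : ℝ) * √T / (α₀ * √(Real.log T)) * 1 := by gcongr
  linarith

theorem sqrt_log_le (h : LargeHorizon α₀ L A T N n₀ w) : √(Real.log T) ≤ √T :=
  Real.sqrt_le_sqrt h.log_le

/-- The rounds needed for a window and a delay, when the exploration period is at its longest, are of
the order `√(T log T)`. -/
theorem period_mul_le (h : LargeHorizon α₀ L A T N n₀ w) (hα₀ : 0 < α₀) (hL : 0 ≤ L) :
    (√A * √T / (α₀ * √(Real.log T)) + 1) * w ≤
      L * (√A / α₀ + 1) * √(T * Real.log T) := by
  have hl := h.one_le_log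
  have hl0 : 0 < √(Real.log T) := Real.sqrt_pos.2 (by linarith)
  have hl2 : √(Real.log T) * √(Real.log T) = Real.log T := Real.mul_self_sqrt (by linarith)
  have hlT := h.sqrt_log_le
  calc (√A * √T / (α₀ * √(Real.log T)) + 1) * w
      ≤ (√A * √T / (α₀ * √(Real.log T)) + 1) * (L * Real.log T) := by
        gcongr
        exact h.delay_le
    _ = L * (√A / α₀ * (√T * √(Real.log T)) + √(Real.log T) * √(Real.log T)) := by
        generalize √(Real.log T) = l at hl0 hl2 ⊢
        rw [← hl2]
        field_simp
    _ ≤ L * (√A / α₀ * (√T * √(Real.log T)) + √T * √(Real.log T)) := by gcongr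
    _ = L * (√A / α₀ + 1) * √(T * Real.log T) := by
        rw [Real.sqrt_mul (Nat.cast_nonneg T)]; ring

theorem arm_mul_changes_le (h : LargeHorizon α₀ L A T N n₀ w) :
    (A : ℝ) * N ≤ √(A * N * T * Real.log T) := by
  have hl := h.one_le_log
  refine Real.le_sqrt_of_sq_le ?_
  have hN : (N : ℝ) ≤ T := by
    have h1 := h.changes_le
    have h2 : 1 ≤ √(T * Real.log T) := Real.one_le_sqrt.2 (by
      have := h.log_le
      nlinarith)
    nlinarith [(Nat.cast_nonneg N : (0 : ℝ) ≤ N)]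
  calc ((A : ℝ) * N) ^ 2 = A * N * N * A := by ring
    _ ≤ A * N * T * Real.log T := by
      gcongr
      exact h.arm_le

theorem changes_mul_log_le (h : LargeHorizon α₀ L A T N n₀ w) :
    (N : ℝ) * Real.log T ≤ √(A * N * T * Real.log T) := by
  have hl := h.one_le_log
  have hN : (1 : ℝ) ≤ N := by exact_mod_cast h.one_le
  have hA : (1 : ℝ) ≤ A := by exact_mod_cast h.arm_pos
  refine Real.le_sqrt_of_sq_le ?_
  have h1 := h.mul_sqrt_log_le
  have h2 : (N : ℝ) ^ 2 * Real.log T ≤ T := by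
    have := pow_le_pow_left₀ (by positivity) h1 2
    rwa [mul_pow, Real.sq_sqrt (by linarith), Real.sq_sqrt (by positivity)] at this
  have h3 : Real.log T ≤ 1 * N * Real.log T := by nlinarith
  have h4 : (N : ℝ) * Real.log T ≤ N * T := by
    gcongr
    exact h.log_le
  calc ((N : ℝ) * Real.log T) ^ 2 = (N ^ 2 * Real.log T) * Real.log T := by ring
    _ ≤ T * Real.log T := by gcongr
    _ ≤ (A * N) * (T * Real.log T) := by
      refine le_mul_of_one_le_left (by positivity) ?_
      nlinarith
    _ = A * N * T * Real.log T := by ring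

theorem freq_mul_le (h : LargeHorizon α₀ L A T N n₀ w) (hα₀ : 0 < α₀) :
    freq α₀ A T (N + 1) * T ≤ 2 * α₀ * √(A * N * T * Real.log T) := by
  have h3 : (0 : ℝ) < √(T : ℝ) := Real.sqrt_pos.2 (by
    have := h.three_le
    exact_mod_cast (by omega : 0 < T))
  rw [freq_eq]
  have hT2 : √(T : ℝ) * √T = T := Real.mul_self_sqrt (Nat.cast_nonneg T)
  have h1 := h.sqrt_succ_le
  calc α₀ * (√((N + 1 : ℕ) : ℝ) * √A * √(Real.log T) / √T) * T
      = α₀ * (√((N + 1 : ℕ) : ℝ) * √A * √(Real.log T) / √T) * (√T * √T) := by rw [hT2]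
    _ = α₀ * (√((N + 1 : ℕ) : ℝ) * √A * √(Real.log T) * √T) := by field_simp
    _ ≤ α₀ * (2 * √N * √A * √(Real.log T) * √T) := by gcongr
    _ = 2 * α₀ * √(A * N * T * Real.log T) := by
      rw [Real.sqrt_mul (by positivity), Real.sqrt_mul (by positivity),
        Real.sqrt_mul (by positivity)]
      ring

theorem sum_latencyAt_le (h : LargeHorizon α₀ L A T N n₀ w) (hα₀ : 0 < α₀) (hL : 0 ≤ L) {d : ℕ}
    (hd : d ≤ w) :
    ∑ k ∈ Finset.range (N + 1), (latencyAt A (freq α₀ A T) d k : ℝ) ≤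
      L * (2 / α₀ + 1) * √(A * N * T * Real.log T) := by
  have hl := h.one_le_log
  have hl0 : 0 < √(Real.log T) := Real.sqrt_pos.2 (by linarith)
  have hl2 : √(Real.log T) * √(Real.log T) = Real.log T := Real.mul_self_sqrt (by linarith)
  have hdL : (d : ℝ) ≤ L * Real.log T := le_trans (by exact_mod_cast hd) h.delay_le
  set c := √(A : ℝ) * √T / (α₀ * √(Real.log T)) with hc
  have hc0 : 0 ≤ c := by positivity
  have hQ : √(A * N * T * Real.log T) = √A * √N * √T * √(Real.log T) := by
    rw [Real.sqrt_mul (by positivity), Real.sqrt_mul (by positivity),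
      Real.sqrt_mul (by positivity)]
  have hterm : ∀ k ∈ Finset.range N, (latencyAt A (freq α₀ A T) d (k + 1) : ℝ) ≤
      (c * (1 / √((k + 1 : ℕ) : ℝ)) + 1) * (L * Real.log T) := by
    intro k _
    rw [latencyAt, if_neg (by omega), Nat.cast_mul]
    have := period_freq_le hα₀ h.arm_pos (Nat.succ_pos k) (T := T)
      (by have := h.three_le; omega)
    refine mul_le_mul this hdL (by positivity) (by positivity)
  rw [Finset.sum_range_succ']
  calc _ ≤ ∑ k ∈ Finset.range N, (c * (1 / √((k + 1 : ℕ) : ℝ)) + 1) * (L * Real.log T) + 0 :=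
        add_le_add (Finset.sum_le_sum hterm) (by simp [latencyAt])
    _ = (c * ∑ k ∈ Finset.range N, 1 / √((k + 1 : ℕ) : ℝ) + N) * (L * Real.log T) := by
        rw [add_zero, ← Finset.sum_mul, Finset.sum_add_distrib, ← Finset.mul_sum]
        simp
    _ ≤ (c * (2 * √N) + N) * (L * Real.log T) := by
        gcongr
        exact sum_one_div_sqrt_le N
    _ = L * (2 / α₀ * √(A * N * T * Real.log T) + N * Real.log T) := by
        rw [hQ, hc]
        generalize √(Real.log T) = l at hl0 hl2 ⊢
        rw [← hl2]
        field_simp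
    _ ≤ L * (2 / α₀ * √(A * N * T * Real.log T) + √(A * N * T * Real.log T)) := by
        gcongr
        exact h.changes_mul_log_le
    _ = _ := by ring

/-- Cauchy–Schwarz over the intervals between changes. -/
theorem sum_sqrt_le (h : LargeHorizon α₀ L A T N n₀ w) {n : ℕ → ℕ}
    (hn : ∑ k ∈ Finset.range (N + 1), (n k : ℝ) = T) :
    ∑ k ∈ Finset.range (N + 1), √(A * (n k + n₀ : ℕ) * Real.log T) ≤
      2 * √(A * N * T * Real.log T) := by
  have hl := h.one_le_log
  have hN : (1 : ℝ) ≤ N := by exact_mod_cast h.one_le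
  have hA : (1 : ℝ) ≤ A := by exact_mod_cast h.arm_pos
  have hstart : 2 * N * (n₀ : ℝ) ≤ T := by
    have h1 : (2 * n₀ : ℝ) ≤ √(T * Real.log T) := Real.le_sqrt_of_sq_le h.start_le
    have h2 := h.changes_le
    nlinarith
  have hcs := Real.sum_sqrt_mul_sqrt_le (Finset.range (N + 1)) (f := fun _ => (1 : ℝ))
    (g := fun k => (A * (n k + n₀ : ℕ) * Real.log T : ℝ)) (fun _ => zero_le_one)
    (fun k => by positivity)
  simp only [Real.sqrt_one, one_mul] at hcs
  refine hcs.trans ?_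
  rw [← Real.sqrt_mul (by positivity)]
  have h4 : (2 : ℝ) * √(A * N * T * Real.log T) = √(4 * (A * N * T * Real.log T)) := by
    rw [show (4 : ℝ) = 2 ^ 2 by norm_num, Real.sqrt_mul (x := (2 : ℝ) ^ 2) (by positivity),
      Real.sqrt_sq (by norm_num)]
  rw [h4]
  refine Real.sqrt_le_sqrt ?_
  rw [← Finset.sum_mul, ← Finset.mul_sum]
  push_cast
  rw [Finset.sum_add_distrib, hn]
  simp only [Finset.sum_const, Finset.card_range, nsmul_eq_mul, mul_one]
  push_cast
  have h5 : (T : ℝ) + (N + 1) * n₀ ≤ 2 * T := by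
    nlinarith [(Nat.cast_nonneg n₀ : (0 : ℝ) ≤ n₀)]
  calc ((N : ℝ) + 1) * (A * (T + (N + 1) * n₀) * Real.log T)
      ≤ (2 * N) * (A * (2 * T) * Real.log T) := by
        gcongr
        linarith
    _ = 4 * (A * N * T * Real.log T) := by ring

end LargeHorizon

/-- The conditions of `LargeHorizon` that do not involve the environment. -/
theorem eventually_largeHorizon (α₀ : ℝ) (A : ℕ) (n₀ : ℕ) :
    ∀ᶠ T : ℕ in atTop, 3 ≤ T ∧ n₀ ≤ T ∧ (A : ℝ) ≤ Real.log T ∧ Real.log T ≤ T ∧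
      (2 * n₀ : ℝ) ^ 2 ≤ T * Real.log T ∧ (2 * A * α₀ ^ 2) ^ 2 * Real.log T < T := by
  have hlog : Tendsto (fun T : ℕ => Real.log T) atTop atTop :=
    Real.tendsto_log_atTop.comp tendsto_natCast_atTop_atTop
  have hsmall : ∀ᶠ T : ℕ in atTop,
      ‖Real.log (T : ℝ)‖ ≤ 1 / (2 * ((2 * A * α₀ ^ 2) ^ 2 + 1)) * ‖(T : ℝ)‖ :=
    tendsto_natCast_atTop_atTop.eventually
      (Real.isLittleO_log_id_atTop.def (c := 1 / (2 * ((2 * A * α₀ ^ 2) ^ 2 + 1))) (by positivity))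
  filter_upwards [hsmall, hlog.eventually_ge_atTop (A : ℝ), hlog.eventually_ge_atTop 1,
    eventually_ge_atTop 3, eventually_ge_atTop n₀,
    tendsto_natCast_atTop_atTop.eventually_ge_atTop ((2 * n₀ : ℝ) ^ 2)]
    with T h1 h2 h3 h4 h5 h6
  refine ⟨h4, h5, h2, Real.log_le_self (Nat.cast_nonneg _), by nlinarith, ?_⟩
  have hT : (0 : ℝ) < T := by exact_mod_cast (by omega : 0 < T)
  rw [Real.norm_of_nonneg (by linarith), Real.norm_of_nonneg hT.le] at h1
  set b := (2 * (A : ℝ) * α₀ ^ 2) ^ 2 with hb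
  have hb0 : 0 ≤ b := by positivity
  rw [div_mul_eq_mul_div, one_mul, le_div_iff₀ (by positivity)] at h1
  nlinarith [mul_nonneg hb0 (show 0 ≤ Real.log T by linarith)]

/-! ### Summation over the intervals -/

namespace LargeHorizon

variable {α₀ L : ℝ} {n₀ w : ℕ}

theorem separationCondition {E : PSBandit A T} (h : LargeHorizon α₀ L A T E.N n₀ w) (hα₀ : 0 < α₀)
    (hL : 0 ≤ L) {m d : ℕ} (hw : m + d = w)
    (hsep : L * (√A / α₀ + 1) * √(T * Real.log T) ≤ E.minSeparation) :
    SeparationCondition E (freq α₀ A T) m d := by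
  intro k hk
  obtain ⟨hk1, hkN⟩ := Finset.mem_Icc.1 hk
  refine le_trans ?_ (E.minSeparation_le hk1 hkN)
  set P := √(A : ℝ) * √T / (α₀ * √(Real.log T)) + 1 with hP
  have hP0 : 0 ≤ P := by positivity
  have h1 : (latencyAt A (freq α₀ A T) d (k - 1) : ℝ) ≤ P * d := by
    rw [latencyAt]
    split_ifs with h0
    · push_cast
      positivity
    · push_cast
      exact mul_le_mul_of_nonneg_right (h.period_le hα₀ (by omega)) (Nat.cast_nonneg _)
  have h2 : (windowAt A (freq α₀ A T) m k : ℝ) ≤ P * m := by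
    rw [windowAt]
    push_cast
    exact mul_le_mul_of_nonneg_right (h.period_le hα₀ (by omega)) (Nat.cast_nonneg _)
  have h3 := h.period_mul_le hα₀ hL
  have h4 : (w : ℝ) = m + d := by rw [← hw]; push_cast; ring
  rw [← hP, h4] at h3
  have h5 : ((latencyAt A (freq α₀ A T) d (k - 1) + windowAt A (freq α₀ A T) m k : ℕ) : ℝ) ≤
      E.minSeparation := by
    push_cast
    linarith
  exact_mod_cast h5

/-- The regret bound of the procedure, for a large horizon: false alarms and missed detections,
delays, forced exploration and the regret of the bandit algorithm each contribute at most the order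
`√(A N T log T)`. -/
theorem regret_le {E : PSBandit A T} (h : LargeHorizon α₀ L A T E.N n₀ w) (hα₀ : 0 < α₀)
    (hL : 0 ≤ L) {C c δ : ℝ} (hC0 : 0 ≤ C) (hc : 0 ≤ c) {m d : ℕ} (hw : m + d = w)
    {D : ChangeDetector} (hD : E.Detectable D (freq α₀ A T) δ m d) (hδ : T * δ ≤ 1)
    (hC : ∀ k ≤ E.N, ∀ a, gap (E.law (k + 1)) a ≤ C) (B : BanditAlg A)
    (hB : ∀ k ≤ E.N, ∀ n ≤ T, B.regret (E.law (k + 1)) n ≤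
      c * √(A * (n + n₀ : ℕ) * Real.log T)) :
    regret E B D (freq α₀ A T) ≤
      (4 * C + C * (L * (2 / α₀ + 1)) + (2 * C * α₀ + 2 * C) + 2 * c) *
        √(A * E.N * T * Real.log T) := by
  set Q := √(A * E.N * T * Real.log T) with hQ
  have hN : (1 : ℝ) ≤ E.N := by exact_mod_cast h.one_le
  have hA : (1 : ℝ) ≤ A := by exact_mod_cast h.arm_pos
  have hδ0 := hD.level_nonneg
  have hAN := h.arm_mul_changes_le
  rw [← hQ] at hAN
  have hmem : ∀ k ∈ Finset.range (E.N + 1), k ≤ E.N := fun k hk =>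
    Nat.lt_succ_iff.1 (Finset.mem_range.1 hk)
  have hlen := E.sum_length
  refine (hD.regret_le hC0 hC B).trans ?_
  rw [Finset.sum_add_distrib, Finset.sum_add_distrib, Finset.sum_add_distrib]
  have h1 : ∑ k ∈ Finset.range (E.N + 1),
      C * (E.ν (k + 1) - E.ν k : ℕ) * ((k + 1) * ((A + 1) * δ)) ≤ 4 * C * Q := by
    calc _ ≤ ∑ k ∈ Finset.range (E.N + 1),
          C * (E.ν (k + 1) - E.ν k : ℕ) * ((2 * E.N) * ((2 * A) * δ)) := by
          refine Finset.sum_le_sum fun k hk => ?_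
          have : (k : ℝ) ≤ E.N := by exact_mod_cast hmem k hk
          gcongr <;> linarith
      _ = 4 * C * (A * E.N) * (T * δ) := by
          rw [← Finset.sum_mul, ← Finset.mul_sum, hlen]
          ring
      _ ≤ 4 * C * Q * 1 := by gcongr
      _ = 4 * C * Q := mul_one _
  have h2 : ∑ k ∈ Finset.range (E.N + 1), C * (latencyAt A (freq α₀ A T) d k : ℝ) ≤
      C * (L * (2 / α₀ + 1)) * Q := by
    rw [← Finset.mul_sum, mul_assoc]
    exact mul_le_mul_of_nonneg_left (h.sum_latencyAt_le hα₀ hL (by omega)) hC0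
  have h3 : ∑ k ∈ Finset.range (E.N + 1), C * (A * (((E.ν (k + 1) - E.ν k : ℕ) : ℝ) /
      period A (freq α₀ A T) (k + 1) + 1)) ≤ (2 * C * α₀ + 2 * C) * Q := by
    calc _ ≤ ∑ k ∈ Finset.range (E.N + 1), (C * freq α₀ A T (E.N + 1) *
          (E.ν (k + 1) - E.ν k : ℕ) + C * A) := by
          refine Finset.sum_le_sum fun k hk => ?_
          have := h.div_period_le hα₀ (hmem k hk)
          calc C * (A * (((E.ν (k + 1) - E.ν k : ℕ) : ℝ) /
                period A (freq α₀ A T) (k + 1) + 1))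
              = C * (A / period A (freq α₀ A T) (k + 1)) * (E.ν (k + 1) - E.ν k : ℕ) +
                C * A := by ring
            _ ≤ _ := by gcongr
      _ = C * (freq α₀ A T (E.N + 1) * T) + C * (A * E.N + A) := by
          rw [Finset.sum_add_distrib, ← Finset.mul_sum, hlen, Finset.sum_const, Finset.card_range,
            nsmul_eq_mul]
          push_cast
          ring
      _ ≤ C * (2 * α₀ * Q) + C * (Q + Q) := by
          have hA' : (A : ℝ) ≤ Q := by nlinarith
          exact add_le_add (mul_le_mul_of_nonneg_left (h.freq_mul_le hα₀) hC0) (by gcongr)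
      _ = _ := by ring
  have h4 : ∑ k ∈ Finset.range (E.N + 1), B.regret (E.law (k + 1)) (E.ν (k + 1) - E.ν k) ≤
      2 * c * Q := by
    have hle : ∀ k ∈ Finset.range (E.N + 1), E.ν (k + 1) - E.ν k ≤ T := by
      intro k hk
      have := E.ν_le (show k + 1 ≤ E.N + 1 by have := hmem k hk; omega)
      have := E.one_le_ν (show k ≤ E.N + 1 by have := hmem k hk; omega)
      omega
    calc _ ≤ ∑ k ∈ Finset.range (E.N + 1),
          c * √(A * ((E.ν (k + 1) - E.ν k) + n₀ : ℕ) * Real.log T) :=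
          Finset.sum_le_sum fun k hk => hB k (hmem k hk) _ (hle k hk)
      _ ≤ c * (2 * Q) := by
          rw [← Finset.mul_sum]
          exact mul_le_mul_of_nonneg_left (h.sum_sqrt_le hlen) hc
      _ = 2 * c * Q := by ring
  linarith

end LargeHorizon

/-- Below the threshold `n₀`, the regret is bounded by that of `n₀` rounds. -/
theorem BanditAlg.regret_le_of_eventually {A : ℕ} {B : BanditAlg A} {σ : ℝ≥0} {C c : ℝ}
    {R : ℕ → ℝ} (hR : B.HasRegretBound σ C R) {n₀ : ℕ}
    (hn₀ : ∀ n ≥ n₀, R n ≤ c * √((A : ℝ) * n * Real.log n))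
    {P : Fin A → ProbabilityMeasure ℝ} (hP : ∀ a, IsSubGaussian σ (P a)) (hgap : ∀ a, gap P a ≤ C)
    {T n : ℕ} (hn : n ≤ T) (hT : n₀ ≤ T) :
    B.regret P n ≤ |c| * √(A * (n + n₀ : ℕ) * Real.log T) := by
  set n' := max n n₀ with hn'
  by_cases h0 : n + n₀ = 0
  · have : n = 0 := by omega
    subst this
    have : B.regret P 0 = 0 := by simp [BanditAlg.regret]
    rw [this]
    positivity
  refine (B.regret_mono P (show n ≤ n' by omega)).trans ((hR P hP hgap n').trans
    ((hn₀ n' (by omega)).trans ?_))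
  have h1 : (n' : ℝ) ≤ (n + n₀ : ℕ) := by exact_mod_cast (by omega : n' ≤ n + n₀)
  have h2 : (n' : ℝ) ≤ T := by exact_mod_cast (by omega : n' ≤ T)
  have h3 : (0 : ℝ) < n' := by exact_mod_cast (by omega : 0 < n')
  have h5 : Real.log n' ≤ Real.log T := Real.log_le_log h3 h2
  have h6 : 0 ≤ Real.log n' := Real.log_natCast_nonneg n'
  refine mul_le_mul (le_abs_self c) (Real.sqrt_le_sqrt ?_) (Real.sqrt_nonneg _) (abs_nonneg _)
  gcongr

theorem level_mem_Ioo {γ : ℝ} (hγ : 1 < γ) {T : ℕ} (hT : 1 < T) :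
    level γ T ∈ Set.Ioo (0 : ℝ) 1 :=
  ⟨Real.rpow_pos_of_pos (by exact_mod_cast (by omega : 0 < T)) _,
    Real.rpow_lt_one_of_one_lt_of_neg (by exact_mod_cast hT) (by linarith)⟩

theorem mul_level_le_one {γ : ℝ} (hγ : 1 < γ) {T : ℕ} (hT : 1 < T) : T * level γ T ≤ 1 := by
  have hT0 : (0 : ℝ) < T := by exact_mod_cast (by omega : 0 < T)
  have : (T : ℝ) * level γ T = (T : ℝ) ^ (1 + -γ) := by
    rw [Real.rpow_add hT0, Real.rpow_one, level]
  rw [this]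
  exact Real.rpow_le_one_of_one_le_of_nonpos (by exact_mod_cast hT.le) (by linarith)

theorem log_one_div_level (γ : ℝ) {T : ℕ} (hT : 0 < T) :
    Real.log (1 / level γ T) = γ * Real.log T := by
  rw [one_div, Real.log_inv, level, Real.log_rpow (by exact_mod_cast hT)]
  ring

end DAB

theorem corollary2
    (σ : ℝ≥0) (C Δ α₀ γ : ℝ) (hΔ : 0 < Δ) (hα₀ : 0 < α₀) (hγ : 1 < γ)
    -- the stationary bandit algorithm, for each number of arms, and its regret bound
    (B : ∀ A : ℕ+, DAB.BanditAlg A) (R : ℕ+ → ℕ → ℝ)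
    (hR : ∀ A : ℕ+, (B A).HasRegretBound σ C (R A))
    (hRO : ∃ c : ℝ, ∀ A : ℕ+, ∀ᶠ n : ℕ in atTop, R A n ≤ c * √((A : ℝ) * n * Real.log n))
    -- the change detector, its pre-change window and its latency
    (D : ℕ → ℝ → ℝ → DAB.ChangeDetector) (m d : ℝ → ℕ → ℝ → ℝ → ℕ)
    (hD : DAB.IsGoodDetector σ D m d) :
    ∃ K : ℝ, 0 < K ∧ ∀ A : ℕ+, ∃ K₀ : ℝ, 0 < K₀ ∧ ∀ᶠ T : ℕ in atTop,
      ∀ E : DAB.PSBandit A T, E.Admissible σ C Δ → 1 ≤ E.N →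
        K₀ * √((T : ℝ) * Real.log T) ≤ (E.minSeparation : ℝ) →
          DAB.SeparationCondition E (DAB.freq α₀ A T)
              (m Δ T (DAB.level γ T) (DAB.level γ T)) (d Δ T (DAB.level γ T) (DAB.level γ T)) ∧
            DAB.regret E (B A) (D T (DAB.level γ T) (DAB.level γ T)) (DAB.freq α₀ A T) ≤
              K * √((A : ℝ) * E.N * T * Real.log T) := by
  obtain ⟨c, hc⟩ := hRO
  obtain ⟨KΔ, hKΔ⟩ := hD.log_growth Δ hΔ
  set L : ℝ := |KΔ| * (1 + 2 * γ) with hLdef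
  have hL : 0 ≤ L := by positivity
  refine ⟨4 * |C| + |C| * (L * (2 / α₀ + 1)) + (2 * |C| * α₀ + 2 * |C|) + 2 * |c| + 1,
    by positivity, fun A => ?_⟩
  obtain ⟨n₀, hn₀⟩ := eventually_atTop.1 (hc A)
  refine ⟨L * (√A / α₀ + 1) + 1, by positivity, ?_⟩
  filter_upwards [DAB.eventually_largeHorizon α₀ A n₀, hKΔ]
    with T ⟨hT3, hTn, hlogA, hlogT, hstart, hfreq⟩ hgrowth E hE hN hsep
  set δ := DAB.level γ T with hδ
  have hδmem : δ ∈ Set.Ioo (0 : ℝ) 1 := DAB.level_mem_Ioo hγ (by omega)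
  have hA : (1 : ℝ) ≤ (A : ℕ) := by exact_mod_cast A.pos
  have hlog0 : 0 ≤ Real.log T := by linarith
  have hS0 : 0 ≤ √((T : ℝ) * Real.log T) := Real.sqrt_nonneg _
  have hx0 : 0 ≤ L * (√(A : ℝ) / α₀ + 1) := by positivity
  have hdelay : ((m Δ T δ δ + d Δ T δ δ : ℕ) : ℝ) ≤ L * Real.log T := by
    refine (hgrowth δ hδmem δ hδmem).trans ?_
    rw [hδ, DAB.log_one_div_level γ (by omega),
      show Real.log T + γ * Real.log T + γ * Real.log T = (1 + 2 * γ) * Real.log T by ring,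
      hLdef, mul_assoc]
    exact mul_le_mul_of_nonneg_right (le_abs_self _) (by positivity)
  have hlarge : DAB.LargeHorizon α₀ L A T E.N n₀ (m Δ T δ δ + d Δ T δ δ) :=
    { arm_pos := A.pos
      three_le := hT3
      one_le := hN
      arm_le := hlogA
      log_le := hlogT
      start_le := hstart
      freq_lt := hfreq
      delay_le := hdelay
      changes_le := by
        have h1 : √((T : ℝ) * Real.log T) ≤ E.minSeparation := by nlinarith
        calc (E.N : ℝ) * √(T * Real.log T) ≤ E.N * E.minSeparation := by gcongr
          _ ≤ T := by exact_mod_cast E.mul_minSeparation_le }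
  have hsepc : DAB.SeparationCondition E (DAB.freq α₀ A T) (m Δ T δ δ) (d Δ T δ δ) :=
    hlarge.separationCondition hα₀ hL rfl (by nlinarith)
  refine ⟨hsepc, ?_⟩
  have hdet := hE.detectable hΔ hD hδmem hT3 A.pos (fun k hk => hlarge.lt_period hα₀ hk) hsepc
  have hgap : ∀ k ≤ E.N, ∀ a, DAB.gap (E.law (k + 1)) a ≤ C := fun k hk =>
    hE.gap_le (k + 1) (Finset.mem_Icc.2 ⟨by omega, by omega⟩)
  have hC0 : 0 ≤ C := (DAB.gap_nonneg _ ⟨0, A.pos⟩).trans (hgap 0 (Nat.zero_le _) _)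
  have hreg := hlarge.regret_le hα₀ hL hC0 (abs_nonneg c) rfl hdet
    (DAB.mul_level_le_one hγ (by omega)) hgap (B A) fun k hk n hn =>
      DAB.BanditAlg.regret_le_of_eventually (hR A) hn₀
        (hE.subGaussian (k + 1) (Finset.mem_Icc.2 ⟨by omega, by omega⟩)) (hgap k hk) hn hTn
  rw [abs_of_nonneg hC0]
  refine hreg.trans (mul_le_mul_of_nonneg_right ?_ (Real.sqrt_nonneg _))
  linarith
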